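/- **Definitions.** Let $\mathbb K$ be an arbitrary field, $V$ an $\ell$-dimensional $\mathbb K$-vector space, and $\mathcal A$ a finite set of linear hyperplanes in $V$ with defining polynomial $Q(\mathcal A)=\prod_{H\in\mathcal A}\alpha_H$ in $S=S(V^*)$, where $H=\ker\alpha_H$. Then $\mathcal A$ is *free with exponents* $\exp(\mathcal A)=(e_1,\dots,e_\ell)_\le$, $e_1\le\dots\le e_\ell$, if the $S$-module $D(\mathcal A)=\{\theta\in\operatorname{Der}_{\mathbb K}(S)\mid\theta(Q(\mathcal A))\in Q(\mathcal A)S\}$ has a basis of homogeneous derivations of degrees $e_1,\dots,e_\ell$ (polynomial degree of the coefficients). Let $L(\mathcal A)$ be the set of all intersections of hyperplanes of $\mathcal A$ (including $V$), let $c=\dim\bigcap_{H\in\mathcal A}H$, and for $X\in L(\mathcal A)$ let $\mathcal A^X=\{H\cap X\mid H\in\mathcal A,\ X\not\subseteq H\}$, an arrangement in $X$. A free arrangement $\mathcal A$ with $\exp(\mathcal A)=(e_1,\dots,e_\ell)_\le$ is *accurate* if it has a *witness* $(X_d)_{\max(1,c)\le d\le\ell}$, that is, flats $X_d\in L(\mathcal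 A)$ with $\dim X_d=d$ such that $\mathcal A^{X_d}$ is free with $\exp(\mathcal A^{X_d})=(e_1,\dots,e_d)_\le$ for all $d$ in this range. (All members of $L(\mathcal A)$ have dimension at least $c$, so for non-essential arrangements the notion is that of the essentialization. For $c\le 1$ the range is $1\le d\le\ell$.) It is *$k$-coaccurate* if some witness satisfies $X_i\subseteq X_j$ for all $i\le j\le\ell-k$ in the range, and *strictly $k$-coaccurate* if for some witness $k$ is the least element of $\{1,\dots,\ell-1\}$ with this property. It is *flag-accurate* if it is $1$-coaccurate, that is, if some witness is a flag. For a finite simple graph $G$ with vertices $v_1,\dots,v_\ell$, the *graphic arrangement* $\mathcal A_G$ in $\mathbb K^\ell$ consists of the hyperplanes $\ker(x_i-x_j)$ for the edges $\{v_i,v_j\}$ of $G$. Let $G+v$ be the graph obtained from $G$ by adding a new vertex $v$ adjacent to all vertices of $G$ (a dominating vertex). Let $\mathcal G$ be the smallest class of simple graphs (up to isomorphism) that contains the one-vertex graph $K_1$ and is closed under disjoint union, under vertex identification (gluing two graphs along one vertex of each), and under $G\mapsto G+v$. *Trivially perfect* graphs are the graphs that can be constructed from $K_1$ by disjoint unions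 and additions of dominating vertices. **Theorem.** Let $\mathbb K$ be a field and $G$ a finite simple graph on $\ell$ vertices. 1. If $G\in\mathcal G$, then $\mathcal A_G$ is flag-accurate. 2. In particular, if $G$ is trivially perfect, then $\mathcal A_G$ is flag-accurate. 3. Let $1\le k\le\ell-1$. If $\mathcal A_G$ is $k$-coaccurate, then so is $\mathcal A_{G+v}$. If $\mathcal A_G$ is strictly $k$-coaccurate, then so is $\mathcal A_{G+v}$. 4. If $\mathcal A_G$ is accurate, then so is $\mathcal A_{G+v}$; if $\mathcal A_G$ is flag-accurate, then so is $\mathcal A_{G+v}$. -/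

import Mathlib

universe u v

noncomputable section

/-- A central hyperplane arrangement in a `K`-vector space `V`: a finite collection of linear
hyperplanes, i.e. of maximal proper linear subspaces. -/
structure CentralArrangement (K : Type*) (V : Type*) [Field K] [AddCommGroup V] [Module K V] where
  hyperplanes : Set (Submodule K V)
  finite : hyperplanes.Finite
  isCoatom : ∀ H ∈ hyperplanes, IsCoatom H

namespace CentralArrangement

section General

variable {K : Type*} {V : Type*} [Field K] [AddCommGroup V] [Module K V]

theorem exists_form_of_isCoatom {H : Submodule K V} (hH : IsCoatom H) :
    ∃ α : Module.Dual K V, LinearMap.ker α = H := by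
  obtain ⟨x, hx⟩ : ∃ x, x ∉ H := by
    by_contra! h
    exact hH.1 (Submodule.eq_top_iff'.2 h)
  obtain ⟨α, hα, hle⟩ := Submodule.exists_le_ker_of_notMem hx
  refine ⟨α, ?_⟩
  rcases hH.le_iff.1 hle with h | h
  · exact absurd (by rw [LinearMap.ker_eq_top.1 h]; rfl) hα
  · exact h

open Classical in
/-- A linear form `α_H` with kernel `H` (unique up to a nonzero scalar). -/
def form (H : Submodule K V) : Module.Dual K V :=
  if h : ∃ α : Module.Dual K V, LinearMap.ker α = H then h.choose else 0

theorem ker_form {H : Submodule K V} (hH : IsCoatom H) : LinearMap.ker (form H) = H := by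
  have h := exists_form_of_isCoatom hH
  rw [form, dif_pos h]
  exact h.choose_spec

variable (A : CentralArrangement K V)

/-- The defining polynomial `Q(A) = ∏ α_H` in the symmetric algebra `S = S(V*)`. -/
def definingPoly : SymmetricAlgebra K (Module.Dual K V) :=
  ∏ H ∈ A.finite.toFinset, SymmetricAlgebra.ι K (Module.Dual K V) (form H)

/-- The module of `A`-derivations `D(A) = {θ ∈ Der(S) | θ(Q(A)) ∈ Q(A) S}`. -/
def derivationModule : Submodule (SymmetricAlgebra K (Module.Dual K V))
    (Derivation K (SymmetricAlgebra K (Module.Dual K V))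
      (SymmetricAlgebra K (Module.Dual K V))) where
  carrier := {θ | θ A.definingPoly ∈ Ideal.span {A.definingPoly}}
  zero_mem' := by simp
  add_mem' := by
    intro θ η hθ hη
    simpa using Ideal.add_mem _ hθ hη
  smul_mem' := by
    intro f θ hθ
    simpa using Ideal.mul_mem_left _ f hθ

/-- A derivation of `S(V*)` is homogeneous of degree `p` if it is nonzero and maps `V*` into the
space `S_p` of homogeneous polynomials of degree `p`; here `S_p` is the `p`-th power of the
subspace `V*` of `S(V*)`. -/
def IsHomogeneousDerivation
    (θ : Derivation K (SymmetricAlgebra K (Module.Dual K V))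
      (SymmetricAlgebra K (Module.Dual K V))) (p : ℕ) : Prop :=
  θ ≠ 0 ∧ ∀ x : Module.Dual K V, θ (SymmetricAlgebra.ι K (Module.Dual K V) x) ∈
    (LinearMap.range (SymmetricAlgebra.ι K (Module.Dual K V))) ^ p

/-- `A` is free with exponents `e = (e_1, …, e_ℓ)`: the module `D(A)` has an `S`-basis of
homogeneous derivations of degrees `e_1, …, e_ℓ`. The order of the list is irrelevant. -/
def IsFreeWithExponents (e : List ℕ) : Prop :=
  ∃ θ : Module.Basis (Fin e.length) (SymmetricAlgebra K (Module.Dual K V)) A.derivationModule,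
    ∀ i, IsHomogeneousDerivation (θ i : Derivation K (SymmetricAlgebra K (Module.Dual K V))
      (SymmetricAlgebra K (Module.Dual K V))) (e.get i)

/-- The intersection lattice `L(A)`: all intersections of subfamilies of `A`, including `V`. -/
def intersectionLattice : Set (Submodule K V) :=
  {X | ∃ B ⊆ A.hyperplanes, X = sInf B}

/-- The center of `A`: the intersection of all hyperplanes, the smallest member of `L(A)`.
Its dimension is `dim V - rk(A)`. -/
def center : Submodule K V := sInf A.hyperplanes

/-- The restriction `A^X = {H ∩ X | H ∈ A, X ⊄ H}`, an arrangement in the vector space `X`. -/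
def restriction (X : Submodule K V) : CentralArrangement K X where
  hyperplanes := {Y | ∃ H ∈ A.hyperplanes, ¬ X ≤ H ∧ Y = H.comap X.subtype}
  finite := by
    refine (A.finite.image fun H => H.comap X.subtype).subset ?_
    rintro Y ⟨H, hH, -, rfl⟩
    exact ⟨H, hH, rfl⟩
  isCoatom := by
    rintro Y ⟨H, hH, hX, rfl⟩
    refine (Submodule.isCoatom_comap_or_eq_top X.subtype (A.isCoatom H hH)).resolve_right ?_
    intro h
    exact hX (by simpa [Submodule.comap_subtype_eq_top] using h)

/-- `X = (X_d)_d` is a witness for the accuracy of `A`: the arrangement `A` is free, say with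
exponents `e_1 ≤ … ≤ e_ℓ`, and for every `d ≤ ℓ` in the range of dimensions that occur in `L(A)`
the flat `X_d ∈ L(A)` has dimension `d` and `A^{X_d}` is free with exponents `(e_1, …, e_d)`.

The dimensions of the members of `L(A)` are exactly those from `dim (center A) = ℓ - rk(A)` up to
`ℓ`; this range of `d` expresses that the property is the one of the essentialization of `A`. If
`ℓ - rk(A) ≤ 1` (for a graphic arrangement: if the graph is connected), then the range is
`1 ≤ d ≤ ℓ`. Values of `X` outside of the range play no role. -/
def IsAccuracyWitness (X : ℕ → Submodule K V) : Prop :=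
  ∃ e : List ℕ, e.Pairwise (· ≤ ·) ∧ A.IsFreeWithExponents e ∧
    ∀ d, 1 ≤ d → Module.finrank K A.center ≤ d → d ≤ Module.finrank K V →
      X d ∈ A.intersectionLattice ∧ Module.finrank K (X d) = d ∧
        (A.restriction (X d)).IsFreeWithExponents (e.take d)

/-- The members of dimension at most `m` of the tuple `X` form a flag `X_1 ⊆ … ⊆ X_m`. -/
def IsFlagUpTo (X : ℕ → Submodule K V) (m : ℕ) : Prop :=
  ∀ i j, 1 ≤ i → Module.finrank K A.center ≤ i → i ≤ j → j ≤ m → X i ≤ X j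

/-- `A` is accurate. -/
def IsAccurate : Prop := ∃ X : ℕ → Submodule K V, A.IsAccuracyWitness X

/-- `A` is `k`-coaccurate: some witness `(X_1, …, X_ℓ)` for the accuracy of `A` has the property
that `(X_1, …, X_{ℓ-k})` is a flag. -/
def IsCoaccurate (k : ℕ) : Prop :=
  ∃ X : ℕ → Submodule K V, A.IsAccuracyWitness X ∧ A.IsFlagUpTo X (Module.finrank K V - k)

/-- `A` is `k`-coaccurate in the strict sense: for some witness `(X_1, …, X_ℓ)` for the accuracy
of `A`, the number `k` is minimal in `{1, …, ℓ-1}` subject to `(X_1, …, X_{ℓ-k})` being a flag. -/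
def IsStrictlyCoaccurate (k : ℕ) : Prop :=
  ∃ X : ℕ → Submodule K V, A.IsAccuracyWitness X ∧
    IsLeast {j : ℕ | 1 ≤ j ∧ j < Module.finrank K V ∧
      A.IsFlagUpTo X (Module.finrank K V - j)} k

/-- `A` is flag-accurate: some witness for the accuracy of `A` is a flag, up to the last member
`X_ℓ = V`, which contains all others anyway. -/
def IsFlagAccurate : Prop := A.IsCoaccurate 1

end General

end CentralArrangement

/-- The hyperplane `ker(x_i - x_j)` in `K^V`. -/
def edgeHyperplane (K : Type v) [Field K] {V : Type u} (i j : V) : Submodule K (V → K) :=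
  LinearMap.ker ((LinearMap.proj i : (V → K) →ₗ[K] K) - (LinearMap.proj j : (V → K) →ₗ[K] K))

/-- The graphic arrangement `A_G = {ker(x_i - x_j) | {i, j} an edge of G}` in `K^V`. -/
def graphicArrangement (K : Type v) [Field K] {V : Type u} [Finite V] (G : SimpleGraph V) :
    CentralArrangement K (V → K) where
  hyperplanes := {H | ∃ i j, G.Adj i j ∧ H = edgeHyperplane K i j}
  finite := by
    refine (Set.finite_range fun p : V × V => edgeHyperplane K p.1 p.2).subset ?_
    rintro H ⟨i, j, -, rfl⟩
    exact ⟨(i, j), rfl⟩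
  isCoatom := by
    classical
    rintro H ⟨i, j, hij, rfl⟩
    refine LinearMap.isCoatom_ker_of_surjective ?_
    intro c
    refine ⟨Pi.single i c, ?_⟩
    simp [hij.ne']

namespace SimpleGraph

/-- `G + v`: the graph obtained from `G` by adding a new vertex `none` adjacent to all vertices
of `G`. -/
def addDominating {V : Type u} (G : SimpleGraph V) : SimpleGraph (Option V) where
  Adj
    | some a, some b => G.Adj a b
    | some _, none => True
    | none, some _ => True
    | none, none => False
  symm := ⟨by rintro (_ | a) (_ | b) h <;> first | trivial | exact G.adj_symm h⟩
  loopless := ⟨by rintro (_ | a) h <;> first | exact h | exact G.loopless.irrefl _ h⟩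

open Classical in
/-- The embedding of the vertices of `H` into the vertices of the vertex identification: `h` goes
to the vertex `g` of `G`, all others to themselves. -/
def identEmbedding {V W : Type u} (g : V) (h : W) : W ↪ V ⊕ {w : W // w ≠ h} where
  toFun w := if hw : w = h then Sum.inl g else Sum.inr ⟨w, hw⟩
  inj' := by
    intro a b hab
    by_cases ha : a = h <;> by_cases hb : b = h <;> simp_all

/-- The vertex identification of `G` and `H`: the union of a copy of `G` and a copy of `H` which
share exactly one vertex, namely `g ∈ G`, which is identified with `h ∈ H`. -/
def vertexIdentification {V W : Type u} (G : SimpleGraph V) (g : V) (H : SimpleGraph W) (h : W) :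
    SimpleGraph (V ⊕ {w : W // w ≠ h}) :=
  G.map (Function.Embedding.inl : V ↪ V ⊕ {w : W // w ≠ h}) ⊔ H.map (identEmbedding g h)

/-- The smallest class of simple graphs, up to isomorphism, that contains the one-vertex graphs
and is closed under disjoint union, vertex identification and adding a dominating vertex. -/
inductive InClassG : ∀ {V : Type u}, SimpleGraph V → Prop
  | single {V : Type u} [Unique V] (G : SimpleGraph V) : InClassG G
  | disjointUnion {V W : Type u} (G : SimpleGraph V) (H : SimpleGraph W) :
      InClassG G → InClassG H → InClassG (G ⊕g H)
  | identify {V W : Type u} (G : SimpleGraph V) (g : V) (H : SimpleGraph W) (h : W) :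
      InClassG G → InClassG H → InClassG (G.vertexIdentification g H h)
  | dominate {V : Type u} (G : SimpleGraph V) : InClassG G → InClassG G.addDominating
  | iso {V W : Type u} (G : SimpleGraph V) (H : SimpleGraph W) :
      Nonempty (G ≃g H) → InClassG G → InClassG H

/-- Trivially perfect graphs: the graphs, up to isomorphism, that can be constructed from
one-vertex graphs by disjoint unions and by adding dominating vertices. -/
inductive IsTriviallyPerfect : ∀ {V : Type u}, SimpleGraph V → Prop
  | single {V : Type u} [Unique V] (G : SimpleGraph V) : IsTriviallyPerfect G
  | disjointUnion {V W : Type u} (G : SimpleGraph V) (H : SimpleGraph W) :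
      IsTriviallyPerfect G → IsTriviallyPerfect H → IsTriviallyPerfect (G ⊕g H)
  | dominate {V : Type u} (G : SimpleGraph V) :
      IsTriviallyPerfect G → IsTriviallyPerfect G.addDominating
  | iso {V W : Type u} (G : SimpleGraph V) (H : SimpleGraph W) :
      Nonempty (G ≃g H) → IsTriviallyPerfect G → IsTriviallyPerfect H

end SimpleGraph

end

open Module

/-! Everything is reduced to splines. Let `X` be a flat of the graphic arrangement of `G` and let `x
v` be the coordinate forms restricted to `X`. A derivation of `S(X*)` is determined by its values `f
v` on these forms, and it preserves the restricted arrangement exactly when `x v - x w` divides `f v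
- f w` for every edge of `G`. An edge contracted by `X` has label `0`, which forces `f v = f w`; so
the same graph serves for all flats, and freeness of a restriction means that a spline module has a
homogeneous basis (`CentralArrangement.isFreeWithExponents_iff`).

Dominating vertex. If the form of the new vertex is independent of the others, a spline on `G + v`
is a constant plus `(x u - x none) * k u` with `k` a spline on `G`. Hence passing from `X` to the
cone over `X` turns exponents `E` into `0, E + 1` (`IsSplineFree.addDominating`). The cones over a
witness for `G` cover the dimensions above `c + 1`, where `c` is the dimension of the center. The
first `c` exponents of `G` vanish, so in dimensions `d` up to `c + 1` the exponents needed are `0,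
1, …, 1`. These are the exponents of every flat of `G + v` inside the cone over the center, and
there any chain of flats will do. The flag conditions for old and new witness correspond with a
shift of one dimension, which gives coaccuracy, also in the strict sense.

Disjoint union and vertex identification. Splines on a disjoint union form a direct sum; under
vertex identification the two constant functions `1` become one, so one exponent `0` is lost. A flag
witness is encoded as a chain of flats (`IsFreeChain`). Chains for two graphs merge like sorted
lists: descending from the top, the step with the larger exponent is undone first
(`IsFreeChain.exists_merge`). The statement about the class then follows by induction on the
construction of the graph. -/

theorem LinearIndependent.exists_basis_sum {K M I : Type*} [Field K] [AddCommGroup M] [Module K M]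
    {v : I → M} (hv : LinearIndependent K v) :
    ∃ (J : Set M) (b : Basis (I ⊕ J) K M), ∀ i, b (Sum.inl i) = v i := by
  refine ⟨_, Basis.sumExtend hv, fun i => ?_⟩
  exact (Basis.reindex_apply _ _ _).trans (Basis.extend_apply_self _ _)

/-! ### Symmetric algebras of vector spaces: linear forms as primes, degrees, extension of scalars
-/

namespace SymmetricAlgebra

section Field

variable {K M N : Type*} [Field K] [AddCommGroup M] [Module K M] [AddCommGroup N] [Module K N]

instance instIsDomainOfField : IsDomain (SymmetricAlgebra K M) :=
  (equivMvPolynomial (Basis.ofVectorSpace K M)).toMulEquiv.isDomain _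

/-- A functional `g` induces an algebra map to `K[T]` that sends `x` to `g x • T`, so `ι x = 0`
makes every functional vanish at `x`. -/
theorem ι_injective : Function.Injective (ι K M) := by
  rw [injective_iff_map_eq_zero]
  intro x hx
  rw [← Module.forall_dual_apply_eq_zero_iff K]
  intro g
  have h : lift (LinearMap.toSpanSingleton K (Polynomial K) Polynomial.X ∘ₗ g) (ι K M x) =
      g x • Polynomial.X := lift_ι_apply _ _
  rw [hx, map_zero, eq_comm, smul_eq_zero] at h
  exact h.resolve_right Polynomial.X_ne_zero

/-- A nonzero vector is part of a basis, hence becomes a variable of a polynomial ring. -/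
theorem prime_ι {α : M} (hα : α ≠ 0) : Prime (ι K M α) := by
  have hs : LinearIndependent K fun _ : Unit => α := LinearIndependent.of_subsingleton () hα
  obtain ⟨J, b, hb⟩ := hs.exists_basis_sum
  rw [← MulEquiv.prime_iff (equivMvPolynomial b), ← hb (), equivMvPolynomial_ι_apply]
  exact MvPolynomial.X_prime

/-- Modulo the line spanned by `α`, divisibility makes the image of `β` zero in the symmetric
algebra of the quotient, where `ι` is injective. -/
theorem mem_span_of_ι_dvd_ι {α β : M} (h : ι K M α ∣ ι K M β) : β ∈ Submodule.span K {α} := by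
  let F : SymmetricAlgebra K M →ₐ[K] SymmetricAlgebra K (M ⧸ Submodule.span K {α}) :=
    lift (ι K _ ∘ₗ (Submodule.span K {α}).mkQ)
  have hF (γ : M) : F (ι K M γ) = ι K _ ((Submodule.span K {α}).mkQ γ) := lift_ι_apply _ _
  have h0 : F (ι K M α) = 0 := by
    rw [hF, Submodule.mkQ_apply,
      (Submodule.Quotient.mk_eq_zero _).2 (Submodule.mem_span_singleton_self α), map_zero]
  have h1 : F (ι K M β) = 0 := zero_dvd_iff.1 (h0 ▸ map_dvd F h)
  rw [hF, map_eq_zero_iff _ ι_injective] at h1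
  simpa using h1

theorem dvd_of_ι_dvd_ι_mul {α β : M} (hβ : β ∉ Submodule.span K {α}) {f : SymmetricAlgebra K M}
    (h : ι K M α ∣ ι K M β * f) : ι K M α ∣ f := by
  by_cases hα : α = 0
  · subst hα
    rw [map_zero, zero_dvd_iff] at h ⊢
    refine (mul_eq_zero.1 h).resolve_left ?_
    rw [map_eq_zero_iff _ ι_injective]
    rintro rfl
    exact hβ (zero_mem _)
  · exact ((prime_ι hα).dvd_or_dvd h).resolve_left fun h => hβ (mem_span_of_ι_dvd_ι h)

theorem eq_algebraMap_of_mem_pow_zero {f : SymmetricAlgebra K M}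
    (hf : f ∈ LinearMap.range (ι K M) ^ 0) :
    f = algebraMap K _ (algebraMapInv f) := by
  rw [pow_zero, Submodule.mem_one] at hf
  obtain ⟨a, rfl⟩ := hf
  rw [algebraMap_leftInverse M a]

theorem algebraMapInv_eq_zero_of_mem_pow {p : ℕ} (hp : p ≠ 0) {f : SymmetricAlgebra K M}
    (hf : f ∈ LinearMap.range (ι K M) ^ p) : algebraMapInv f = 0 := by
  obtain ⟨q, rfl⟩ := Nat.exists_eq_succ_of_ne_zero hp
  rw [pow_succ] at hf
  induction hf using Submodule.mul_induction_on' with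
  | mem_mul_mem a _ b hb =>
    obtain ⟨x, rfl⟩ := hb
    rw [map_mul, algebraMapInv_ι, mul_zero]
  | add a _ b _ ha hb => rw [map_add, ha, hb, add_zero]

theorem lift_mem_pow (φ : M →ₗ[K] N) {p : ℕ} {f : SymmetricAlgebra K M}
    (hf : f ∈ LinearMap.range (ι K M) ^ p) :
    lift (ι K N ∘ₗ φ) f ∈ LinearMap.range (ι K N) ^ p := by
  have h := Submodule.mem_map_of_mem (f := (lift (ι K N ∘ₗ φ)).toLinearMap) hf
  rw [Submodule.map_pow] at h
  refine SetLike.le_def.1 (pow_le_pow_left' ?_ p) h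
  rintro _ ⟨_, ⟨x, rfl⟩, rfl⟩
  exact ⟨φ x, by simp⟩

/-- For an injective linear map `M → N`, the algebra `S(N)` is a polynomial ring over `S(M)`. -/
theorem exists_equiv_mvPolynomial (φ : M →ₗ[K] N) (hφ : Function.Injective φ) :
    ∃ (J : Set N) (e : SymmetricAlgebra K N ≃+* MvPolynomial J (SymmetricAlgebra K M)),
      ∀ f, e (lift (ι K N ∘ₗ φ) f) = MvPolynomial.C f := by
  let b := Basis.ofVectorSpace K M
  have hs : LinearIndependent K (φ ∘ b) :=
    b.linearIndependent.map' φ (LinearMap.ker_eq_bot.2 hφ)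
  -- The vectors that complete the image of a basis of `M` to a basis of `N` are the variables over
  -- `S(M)`.
  obtain ⟨J, b', hb'⟩ := hs.exists_basis_sum
  let b'' := b'.reindex (Equiv.sumComm _ _)
  let e : SymmetricAlgebra K N ≃ₐ[K] MvPolynomial _ (SymmetricAlgebra K M) :=
    ((equivMvPolynomial b'').trans (MvPolynomial.sumAlgEquiv K _ _)).trans
      (MvPolynomial.mapAlgEquiv _ (equivMvPolynomial b).symm)
  refine ⟨J, e.toRingEquiv, fun f => ?_⟩
  have : (e.toAlgHom.comp (lift (ι K N ∘ₗ φ))) =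
      IsScalarTower.toAlgHom K (SymmetricAlgebra K M) (MvPolynomial _ (SymmetricAlgebra K M)) := by
    refine algHom_ext (b.ext fun i => ?_)
    have h1 : φ (b i) = b'' (Sum.inr i) := by simp [b'', hb']
    simp [e, h1, MvPolynomial.algebraMap_eq]
  exact DFunLike.congr_fun this f

end Field

end SymmetricAlgebra

/-! ### Splines on a graph over a commutative ring -/

section Splines

variable {V : Type*} (G : SimpleGraph V) {R : Type*} [CommRing R]

/-- The module of splines on `G` with edge labels `x v - x w`. For the coordinate functions `x` of
a polynomial ring it consists of the coefficient vectors of the derivations of the graphic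
arrangement. -/
def splineModule (x : V → R) : Submodule R (V → R) where
  carrier := {f | ∀ v w, G.Adj v w → x v - x w ∣ f v - f w}
  zero_mem' := by simp
  add_mem' := by
    intro f g hf hg v w h
    rw [Pi.add_apply, Pi.add_apply, add_sub_add_comm]
    exact dvd_add (hf v w h) (hg v w h)
  smul_mem' := by
    intro c f hf v w h
    rw [Pi.smul_apply, Pi.smul_apply, smul_eq_mul, smul_eq_mul, ← mul_sub]
    exact (hf v w h).mul_left c

variable {G}

theorem const_mem_splineModule (x : V → R) (r : R) : (fun _ => r) ∈ splineModule G x :=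
  fun v w _ => by simp

variable (G) in
/-- The family `b` is a basis of the module of splines. -/
structure IsSplineBasis (x : V → R) {ι : Type*} [Fintype ι] (b : ι → V → R) : Prop where
  mem : ∀ i, b i ∈ splineModule G x
  exists_eq_sum : ∀ f ∈ splineModule G x, ∃ c : ι → R, f = ∑ i, c i • b i
  eq_zero : ∀ c : ι → R, ∑ i, c i • b i = 0 → c = 0

theorem Module.Basis.isSplineBasis {x : V → R} {ι : Type*} [Fintype ι]
    (b : Basis ι R (splineModule G x)) : IsSplineBasis G x fun i => (b i : V → R) where
  mem i := (b i).2
  exists_eq_sum f hf := by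
    refine ⟨b.repr ⟨f, hf⟩, ?_⟩
    have h := congrArg (splineModule G x).subtype (b.sum_repr ⟨f, hf⟩)
    rw [map_sum] at h
    exact h.symm
  eq_zero c hc := by
    have h : ∑ i, c i • b i = 0 := Subtype.ext (by simpa using hc)
    exact funext (Fintype.linearIndependent_iff.1 b.linearIndependent c h)

/-- A spline basis as a basis of the module of splines. -/
noncomputable def IsSplineBasis.toBasis {x : V → R} {ι : Type*} [Fintype ι] {b : ι → V → R}
    (hb : IsSplineBasis G x b) : Basis ι R (splineModule G x) :=
  Basis.mk (v := fun i => ⟨b i, hb.mem i⟩)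
    (Fintype.linearIndependent_iff.2 fun c hc =>
      congrFun (hb.eq_zero c (by simpa using congrArg Subtype.val hc)))
    (by
      rintro ⟨f, hf⟩ -
      obtain ⟨c, hc⟩ := hb.exists_eq_sum f hf
      have : (⟨f, hf⟩ : splineModule G x) = ∑ i, c i • ⟨b i, hb.mem i⟩ :=
        Subtype.ext (by simpa using hc)
      rw [this]
      exact Submodule.sum_mem _ fun i _ =>
        Submodule.smul_mem _ _ (Submodule.subset_span ⟨i, rfl⟩))

theorem IsSplineBasis.toBasis_apply {x : V → R} {ι : Type*} [Fintype ι] {b : ι → V → R}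
    (hb : IsSplineBasis G x b) (i : ι) : (hb.toBasis i : V → R) = b i := by
  simp [IsSplineBasis.toBasis]

theorem IsSplineBasis.reindex {x : V → R} {ι κ : Type*} [Fintype ι] [Fintype κ] {b : ι → V → R}
    (hb : IsSplineBasis G x b) (e : κ ≃ ι) : IsSplineBasis G x fun k => b (e k) where
  mem k := hb.mem _
  exists_eq_sum f hf := by
    obtain ⟨c, rfl⟩ := hb.exists_eq_sum f hf
    exact ⟨fun k => c (e k), (e.sum_comp fun i => c i • b i).symm⟩
  eq_zero c hc := by
    have h := hb.eq_zero (fun i => c (e.symm i)) (by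
      rw [← hc, ← e.sum_comp]
      simp)
    funext k
    simpa using congrFun h (e k)

/-- Extending scalars to a polynomial ring preserves bases of spline modules. -/
theorem IsSplineBasis.map [Finite V] {x : V → R} {ι : Type*} [Fintype ι] {b : ι → V → R}
    (hb : IsSplineBasis G x b) {R' J : Type*} [CommRing R'] (h : R →+* R')
    (e : R' ≃+* MvPolynomial J R) (he : ∀ r, e (h r) = MvPolynomial.C r) :
    IsSplineBasis G (fun v => h (x v)) fun i v => h (b i v) := by
  have hmulC (p : MvPolynomial J R) (a : R) (m : J →₀ ℕ) :
      (p * MvPolynomial.C a).coeff m = p.coeff m * a := by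
    rw [mul_comm, MvPolynomial.coeff_C_mul, mul_comm]
  refine ⟨fun i v w hvw => ?_, fun f hf => ?_, fun c hc => ?_⟩
  · rw [← map_sub, ← map_sub]
    exact map_dvd h (hb.mem i v w hvw)
  · classical
    have := Fintype.ofFinite V
    -- The edge labels are constant polynomials, and divisibility by a constant can be tested
    -- coefficientwise. So every coefficient of a spline is a spline over `R`.
    have hcoeff (m : J →₀ ℕ) : (fun v => (e (f v)).coeff m) ∈ splineModule G x := by
      intro v w hvw
      have h1 := map_dvd e (hf v w hvw)
      rw [← map_sub h, he, map_sub e, MvPolynomial.C_dvd_iff_dvd_coeff] at h1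
      simpa using h1 m
    choose c hc using fun m => hb.exists_eq_sum _ (hcoeff m)
    -- The expansions are summed only over the monomials that occur in `f`, to obtain polynomials.
    let s : Finset (J →₀ ℕ) := Finset.univ.biUnion fun v => (e (f v)).support
    refine ⟨fun i => e.symm (∑ m ∈ s, MvPolynomial.monomial m (c m i)), funext fun v => ?_⟩
    apply e.injective
    ext m
    simp only [Finset.sum_apply, Pi.smul_apply, smul_eq_mul, map_sum, map_mul,
      RingEquiv.apply_symm_apply, he, MvPolynomial.coeff_sum, hmulC]
    have hm := congrFun (hc m) v
    simp only [Finset.sum_apply, Pi.smul_apply, smul_eq_mul] at hm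
    simp only [MvPolynomial.coeff_monomial, Finset.sum_ite_eq']
    split_ifs with hms
    · exact hm
    · simp only [zero_mul, Finset.sum_const_zero]
      by_contra h0
      exact hms (Finset.mem_biUnion.2 ⟨v, Finset.mem_univ v, MvPolynomial.mem_support_iff.2 h0⟩)
  · have h0 (m : J →₀ ℕ) : (fun i => (e (c i)).coeff m) = 0 := by
      refine hb.eq_zero _ (funext fun v => ?_)
      have h1 := congrArg (fun p => (e p).coeff m) (congrFun hc v)
      simpa [he, MvPolynomial.coeff_sum, hmulC] using h1
    funext i
    apply e.injective
    ext m
    simpa using congrFun (h0 m) i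

/-- If `1` is a combination of a spline basis, with a unit as the coefficient of `b i₀`, then
`b i₀` can be replaced by `1`, and the other members can be normalized to vanish at `g`. -/
theorem IsSplineBasis.exchange_one {x : V → R} {ι : Type*} [Fintype ι] [DecidableEq ι]
    {b : ι → V → R} (hb : IsSplineBasis G x b) {k : ι → R} (hk : 1 = ∑ i, k i • b i) {i₀ : ι}
    {u : R} (hu : u * k i₀ = 1) (g : V) :
    IsSplineBasis G x fun o : Option {i // i ≠ i₀} => o.elim 1 fun i => b i - b i g • 1 := by
  have hsplit {A : Type _} [AddCommGroup A] (F : ι → A) :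
      ∑ i, F i = F i₀ + ∑ i : {i // i ≠ i₀}, F i := by
    rw [← Finset.add_sum_erase _ _ (Finset.mem_univ i₀)]
    congr 1
    refine Finset.sum_subtype _ (by simp) _
  refine ⟨?_, fun f hf => ?_, fun c hc => ?_⟩
  · rintro (_ | i)
    · exact const_mem_splineModule x 1
    · exact sub_mem (hb.mem i) (Submodule.smul_mem _ _ (const_mem_splineModule x 1))
  · obtain ⟨c, rfl⟩ := hb.exists_eq_sum f hf
    -- Substitute `b i₀ = u * (1 - ∑ k i * b i)`, the sum being over `i ≠ i₀`. Normalizing the other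
    -- members at `g` then moves `∑ c' i * b i g` into the coefficient of `1`.
    let c' : {i // i ≠ i₀} → R := fun i => c i - c i₀ * u * k i
    refine ⟨fun o => o.elim (c i₀ * u + ∑ i, c' i * b i g) c', ?_⟩
    rw [Fintype.sum_option]
    funext v
    have h1 := congrFun hk v
    rw [hsplit] at h1 ⊢
    simp only [Pi.one_apply, Pi.add_apply, Pi.smul_apply, Finset.sum_apply, smul_eq_mul,
      Option.elim_none, Option.elim_some, Pi.sub_apply, mul_one, mul_sub,
      Finset.sum_sub_distrib] at h1 ⊢
    have h2 : ∑ i, c' i * b i v =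
        ∑ i : {i // i ≠ i₀}, c i * b i v - c i₀ * u * ∑ i : {i // i ≠ i₀}, k i * b i v := by
      rw [Finset.mul_sum, ← Finset.sum_sub_distrib]
      exact Finset.sum_congr rfl fun i _ => by simp only [c']; ring
    rw [h2]
    linear_combination (- c i₀ * b i₀ v) * hu + (- c i₀ * u) * h1
  · rw [Fintype.sum_option] at hc
    simp only [Option.elim_none, Option.elim_some] at hc
    set a := c none - ∑ i : {i // i ≠ i₀}, c (some i) * b i g with ha
    have h1 : a • (1 : V → R) + ∑ i : {i // i ≠ i₀}, c (some i) • b i = 0 := by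
      rw [← hc]
      funext v
      simp only [ha, Pi.one_apply, Pi.add_apply, Pi.smul_apply, Finset.sum_apply, smul_eq_mul,
        Pi.sub_apply, mul_one, mul_sub, Finset.sum_sub_distrib]
      ring
    -- Expanding `1` by `hk` gives a relation among the original basis, in which `b i₀` has the
    -- coefficient `a * k i₀`.
    have h2 := hb.eq_zero (fun i => a * k i + if h : i ≠ i₀ then c (some ⟨i, h⟩) else 0) (by
      rw [← h1, hk, Finset.smul_sum]
      simp only [add_smul, Finset.sum_add_distrib, mul_smul]
      congr 1
      rw [hsplit, dif_neg (not_not.2 rfl), zero_smul, zero_add]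
      exact Finset.sum_congr rfl fun i _ => by rw [dif_pos i.2])
    have ha0 : a = 0 := by
      have h3 := congrFun h2 i₀
      simp only [ne_eq, not_true_eq_false, dite_false, add_zero, Pi.zero_apply] at h3
      linear_combination u * h3 - a * hu
    have h4 (i : {i // i ≠ i₀}) : c (some i) = 0 := by
      have h3 := congrFun h2 i
      simpa [ha0, i.2] using h3
    funext o
    rcases o with _ | i
    · simpa [ha0, h4] using ha.symm
    · exact h4 i

end Splines

/-! ### Homogeneous spline bases over symmetric algebras -/

section SplineFree

variable (K : Type*) [Field K] {V : Type*} (G : SimpleGraph V)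
  {M N : Type*} [AddCommGroup M] [Module K M] [AddCommGroup N] [Module K N]

/-- The splines on `G` with edge labels `x v - x w`, for vectors `x v` in `M`, have a basis over
`S(M)` that consists of homogeneous members, the degrees of which form the multiset `s`. -/
def IsSplineFree (x : V → M) (s : Multiset ℕ) : Prop :=
  ∃ (n : ℕ) (b : Fin n → V → SymmetricAlgebra K M) (d : Fin n → ℕ),
    IsSplineBasis G (fun v => SymmetricAlgebra.ι K M (x v)) b ∧
    (∀ i v, b i v ∈ LinearMap.range (SymmetricAlgebra.ι K M) ^ d i) ∧
    ∑ i, ({d i} : Multiset ℕ) = s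

variable {K G}

theorem IsSplineFree.intro {x : V → M} {s : Multiset ℕ} {I : Type*} [Fintype I]
    {b : I → V → SymmetricAlgebra K M} (d : I → ℕ)
    (hb : IsSplineBasis G (fun v => SymmetricAlgebra.ι K M (x v)) b)
    (hd : ∀ i v, b i v ∈ LinearMap.range (SymmetricAlgebra.ι K M) ^ d i)
    (hs : ∑ i, ({d i} : Multiset ℕ) = s) : IsSplineFree K G x s := by
  let e := (Fintype.equivFin I).symm
  exact ⟨_, _, fun k => d (e k), hb.reindex e, fun i v => hd _ v,
    (e.sum_comp fun i => ({d i} : Multiset ℕ)).trans hs⟩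

theorem IsSplineFree.map [Finite V] {x : V → M} {s : Multiset ℕ} (h : IsSplineFree K G x s)
    (φ : M →ₗ[K] N) (hφ : Function.Injective φ) : IsSplineFree K G (fun v => φ (x v)) s := by
  obtain ⟨n, b, d, hb, hd, hs⟩ := h
  obtain ⟨J, e, he⟩ := SymmetricAlgebra.exists_equiv_mvPolynomial φ hφ
  have h1 := hb.map (SymmetricAlgebra.lift (SymmetricAlgebra.ι K N ∘ₗ φ)).toRingHom e he
  refine ⟨n, _, d, ?_, fun i v => SymmetricAlgebra.lift_mem_pow φ (hd i v), hs⟩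
  simpa using h1

/-- The constant spline `1` has degree `0`, so it is a scalar combination of basis members of degree
`0` and can replace one of them. Normalizing the others at `g` subtracts constants of the same
degree. This prepares the gluing of two graphs at the vertex `g`. -/
theorem IsSplineFree.exists_one [Finite V] {x : V → M} {s : Multiset ℕ}
    (h : IsSplineFree K G x s) (g : V) :
    ∃ (I : Type) (_ : Fintype I) (b : I → V → SymmetricAlgebra K M) (d : I → ℕ),
      IsSplineBasis G (fun v => SymmetricAlgebra.ι K M (x v))
        (fun o : Option I => o.elim 1 b) ∧
      (∀ i v, b i v ∈ LinearMap.range (SymmetricAlgebra.ι K M) ^ d i) ∧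
      (∀ i, b i g = 0) ∧ s = 0 ::ₘ ∑ i, {d i} := by
  classical
  obtain ⟨n, b, d, hb, hd, hs⟩ := h
  obtain ⟨c, hc⟩ := hb.exists_eq_sum 1 (const_mem_splineModule _ 1)
  let ε : SymmetricAlgebra K M →ₐ[K] K := SymmetricAlgebra.algebraMapInv
  -- Take constant terms in the expansion of `1`: members of positive degree drop out, and members
  -- of degree `0` equal their constant terms.
  let k : Fin n → K := fun i => if d i = 0 then ε (c i) else 0
  have hk : (1 : V → SymmetricAlgebra K M) =
      ∑ i, algebraMap K (SymmetricAlgebra K M) (k i) • b i := by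
    funext v
    have h1 := congrArg (fun r => algebraMap K (SymmetricAlgebra K M) (ε r)) (congrFun hc v)
    simp only [Pi.one_apply, map_one, Finset.sum_apply, Pi.smul_apply, smul_eq_mul, map_sum,
      map_mul] at h1 ⊢
    rw [h1]
    refine Finset.sum_congr rfl fun i _ => ?_
    by_cases hi : d i = 0
    · simp only [k, hi, if_true]
      rw [← SymmetricAlgebra.eq_algebraMap_of_mem_pow_zero (f := b i v) (hi ▸ hd i v)]
    · simp [k, hi, ε, SymmetricAlgebra.algebraMapInv_eq_zero_of_mem_pow hi (hd i v)]
  obtain ⟨i₀, hi₀⟩ : ∃ i, k i ≠ 0 := by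
    by_contra! h0
    have := congrFun hk g
    simp [h0] at this
  have hdi₀ : d i₀ = 0 := by
    by_contra h0
    simp [k, h0] at hi₀
  have hu : algebraMap K (SymmetricAlgebra K M) (k i₀)⁻¹ * algebraMap K _ (k i₀) = 1 := by
    rw [← map_mul, inv_mul_cancel₀ hi₀, map_one]
  have key := hb.exchange_one hk hu g
  refine ⟨{i // i ≠ i₀}, inferInstance, _, fun i => d i, key, fun i v => ?_, fun i => ?_, ?_⟩
  · refine sub_mem (hd i v) ?_
    simpa using hd i g
  · simp
  · rw [← hs, ← Finset.add_sum_erase _ _ (Finset.mem_univ i₀), hdi₀, Multiset.singleton_add]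
    congr 1
    exact Finset.sum_subtype _ (by simp) _

theorem isSplineFree_of_forall_not_adj [Fintype V] (hG : ∀ v w, ¬ G.Adj v w) (x : V → M) :
    IsSplineFree K G x (Multiset.replicate (Fintype.card V) 0) := by
  classical
  refine IsSplineFree.intro (b := fun v => Pi.single v 1) (fun _ : V => 0) ⟨?_, ?_, ?_⟩ ?_ ?_
  · exact fun i v w h => (hG v w h).elim
  · intro f _
    exact ⟨f, by simpa using pi_eq_sum_univ' f⟩
  · intro c hc
    funext v
    simpa [Pi.single_apply] using congrFun hc v
  · intro v w
    rw [pow_zero]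
    by_cases h : w = v
    · subst h
      simp
    · simp [h]
  · simp [Multiset.nsmul_singleton]

/-- Let `q` be the product of the edge labels, nonzero by `hx`. The module of splines lies between
`q * R^V` and `R^V`, so its rank is the number of vertices. -/
theorem IsSplineFree.card_eq [Fintype V] {x : V → M} {s : Multiset ℕ} (h : IsSplineFree K G x s)
    (hx : ∀ v w, G.Adj v w → x v ≠ x w) : s.card = Fintype.card V := by
  classical
  obtain ⟨n, b, d, hb, -, hs⟩ := h
  have hn : s.card = n := by simp [← hs]
  let x' : V → SymmetricAlgebra K M := fun v => SymmetricAlgebra.ι K M (x v)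
  let B : Basis (Fin n) _ (splineModule G x') := hb.toBasis
  have hfin : Module.finrank (SymmetricAlgebra K M) (splineModule G x') = n := by
    rw [Module.finrank_eq_card_basis B, Fintype.card_fin]
  have := Module.Finite.of_basis B
  let q : SymmetricAlgebra K M :=
    ∏ p : V × V, if G.Adj p.1 p.2 then x' p.1 - x' p.2 else 1
  have hq : q ≠ 0 := by
    refine Finset.prod_ne_zero_iff.2 fun p _ => ?_
    split_ifs with hp
    · rw [← map_sub, Ne, map_eq_zero_iff _ SymmetricAlgebra.ι_injective, sub_eq_zero]
      exact hx _ _ hp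
    · exact one_ne_zero
  have hdvd (v w : V) (hvw : G.Adj v w) : x' v - x' w ∣ q := by
    have h1 := Finset.dvd_prod_of_mem
      (fun p : V × V => if G.Adj p.1 p.2 then x' p.1 - x' p.2 else 1) (Finset.mem_univ (v, w))
    simpa [hvw] using h1
  let t : V → splineModule G x' := fun u => ⟨q • Pi.single u 1, fun v w hvw => by
    rw [Pi.smul_apply, Pi.smul_apply, smul_eq_mul, smul_eq_mul, ← mul_sub]
    exact (hdvd v w hvw).mul_right _⟩
  have ht : LinearIndependent (SymmetricAlgebra K M) t := by
    rw [Fintype.linearIndependent_iff]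
    intro c hc v
    have h1 := congrFun (congrArg (splineModule G x').subtype hc) v
    simp only [map_sum, map_smul, Finset.sum_apply, t, Submodule.subtype_apply, Pi.smul_apply,
      Pi.single_apply, smul_eq_mul, map_zero, Pi.zero_apply] at h1
    simpa [hq] using h1
  refine le_antisymm ?_ ?_
  · have h1 := (B.linearIndependent.map' (splineModule G x').subtype
      (Submodule.ker_subtype _)).fintype_card_le_finrank
    simpa [hn] using h1
  · have h1 := ht.fintype_card_le_finrank
    rwa [hfin, ← hn] at h1

/-- All labels vanish, so splines are constant along edges. The constant terms of a basis span `C`,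
and there are `dim C` of them, so none is zero; a basis member of positive degree would have
constant term zero. -/
theorem IsSplineFree.eq_replicate_zero {x : V → M} {s : Multiset ℕ} [Finite V]
    (h : IsSplineFree K G x s) (C : Submodule K (V → K))
    (hC : ∀ y, y ∈ C ↔ ∀ v w, G.Adj v w → y v = y w)
    (hx : ∀ v w, G.Adj v w → x v = x w) (hs : s.card = Module.finrank K C) :
    s = Multiset.replicate (Module.finrank K C) 0 := by
  obtain ⟨n, b, d, hb, hd, rfl⟩ := h
  have hn : n = Module.finrank K C := by simpa using hs
  let ε : SymmetricAlgebra K M →ₐ[K] K := SymmetricAlgebra.algebraMapInv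
  let β : Fin n → C := fun i => ⟨fun v => ε (b i v), (hC _).2 fun v w hvw => by
    have h1 := hb.mem i v w hvw
    simp only [hx v w hvw, sub_self, zero_dvd_iff, sub_eq_zero] at h1
    rw [h1]⟩
  have hspan : ⊤ ≤ Submodule.span K (Set.range β) := by
    rintro ⟨y, hy⟩ -
    obtain ⟨c, hc⟩ := hb.exists_eq_sum (fun v => algebraMap K _ (y v)) fun v w hvw => by
      simp [(hC y).1 hy v w hvw]
    have : (⟨y, hy⟩ : C) = ∑ i, ε (c i) • β i := by
      apply Subtype.ext
      funext v
      have h1 := congrArg ε (congrFun hc v)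
      simp only [Finset.sum_apply, Pi.smul_apply, smul_eq_mul, map_sum, map_mul] at h1
      have h2 : ε (algebraMap K _ (y v)) = y v := SymmetricAlgebra.algebraMap_leftInverse M _
      rw [h2] at h1
      simpa [β] using h1
    rw [this]
    exact Submodule.sum_mem _ fun i _ => Submodule.smul_mem _ _ (Submodule.subset_span ⟨i, rfl⟩)
  have hli := linearIndependent_of_top_le_span_of_card_eq_finrank hspan (by simpa using hn)
  rw [Multiset.eq_replicate]
  refine ⟨hs, fun m hm => ?_⟩
  obtain ⟨i, -, hi⟩ := Multiset.mem_sum.1 hm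
  rw [Multiset.mem_singleton.1 hi]
  by_contra h0
  refine hli.ne_zero i (Subtype.ext (funext fun v => ?_))
  exact SymmetricAlgebra.algebraMapInv_eq_zero_of_mem_pow h0 (hd i v)

end SplineFree

/-! ### Splines under disjoint union, vertex identification and adding a dominating vertex -/

section Operations

variable {V W U : Type*}

/-- The graph `Γ` is the union of the images of `G` and `H` under the injections `i` and `j`. -/
structure IsGraphUnion (Γ : SimpleGraph U) (G : SimpleGraph V) (H : SimpleGraph W)
    (i : V → U) (j : W → U) : Prop where
  injective_left : Function.Injective i
  injective_right : Function.Injective j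
  cover : ∀ u, (∃ v, i v = u) ∨ ∃ w, j w = u
  adj_iff : ∀ u u', Γ.Adj u u' ↔
    (∃ v v', G.Adj v v' ∧ i v = u ∧ i v' = u') ∨ ∃ w w', H.Adj w w' ∧ j w = u ∧ j w' = u'

variable {Γ : SimpleGraph U} {G : SimpleGraph V} {H : SimpleGraph W} {i : V → U} {j : W → U}

namespace IsGraphUnion

variable (h : IsGraphUnion Γ G H i j)
include h

theorem adj_left {v v' : V} (hv : G.Adj v v') : Γ.Adj (i v) (i v') :=
  (h.adj_iff _ _).2 (Or.inl ⟨v, v', hv, rfl, rfl⟩)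

theorem adj_right {w w' : W} (hw : H.Adj w w') : Γ.Adj (j w) (j w') :=
  (h.adj_iff _ _).2 (Or.inr ⟨w, w', hw, rfl, rfl⟩)

theorem forall_adj {p : U → U → Prop} (hG : ∀ v v', G.Adj v v' → p (i v) (i v'))
    (hH : ∀ w w', H.Adj w w' → p (j w) (j w')) (u u' : U) (hu : Γ.Adj u u') : p u u' := by
  rcases (h.adj_iff u u').1 hu with ⟨v, v', hv, rfl, rfl⟩ | ⟨w, w', hw, rfl, rfl⟩
  · exact hG v v' hv
  · exact hH w w' hw

theorem funext {A : Type*} {f f' : U → A} (hi : ∀ v, f (i v) = f' (i v))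
    (hj : ∀ w, f (j w) = f' (j w)) : f = f' := by
  funext u
  rcases h.cover u with ⟨v, rfl⟩ | ⟨w, rfl⟩
  · exact hi v
  · exact hj w

variable {R : Type*} [CommRing R] {z : U → R}

theorem mem_splineModule_iff {f : U → R} :
    f ∈ splineModule Γ z ↔ (fun v => f (i v)) ∈ splineModule G (fun v => z (i v)) ∧
      (fun w => f (j w)) ∈ splineModule H (fun w => z (j w)) :=
  ⟨fun hf => ⟨fun _ _ hv => hf _ _ (h.adj_left hv), fun _ _ hw => hf _ _ (h.adj_right hw)⟩,
    fun hf => h.forall_adj hf.1 hf.2⟩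

/-- The splines on a disjoint union. -/
theorem isSplineBasis_of_disjoint (hd : ∀ v w, i v ≠ j w) {I J : Type*} [Fintype I] [Fintype J]
    {b : I → V → R} {b' : J → W → R} (hb : IsSplineBasis G (fun v => z (i v)) b)
    (hb' : IsSplineBasis H (fun w => z (j w)) b') :
    IsSplineBasis Γ z (Sum.elim (fun a => Function.extend i (b a) 0)
      fun a => Function.extend j (b' a) 0) := by
  have hi (f : V → R) (v : V) : Function.extend i f 0 (i v) = f v :=
    h.injective_left.extend_apply _ _ _
  have hj (f : W → R) (w : W) : Function.extend j f 0 (j w) = f w :=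
    h.injective_right.extend_apply _ _ _
  have hij (f : V → R) (w : W) : Function.extend i f 0 (j w) = 0 :=
    Function.extend_apply' _ _ _ fun ⟨v, hv⟩ => hd v w hv
  have hji (f : W → R) (v : V) : Function.extend j f 0 (i v) = 0 :=
    Function.extend_apply' _ _ _ fun ⟨w, hw⟩ => hd v w hw.symm
  have hsum (c : I ⊕ J → R) (v : V) :
      (∑ a, c a • Sum.elim (fun a => Function.extend i (b a) 0)
        (fun a => Function.extend j (b' a) 0) a) (i v) = (∑ a, c (Sum.inl a) • b a) v := by
    simp [hi, hji]
  have hsum' (c : I ⊕ J → R) (w : W) :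
      (∑ a, c a • Sum.elim (fun a => Function.extend i (b a) 0)
        (fun a => Function.extend j (b' a) 0) a) (j w) = (∑ a, c (Sum.inr a) • b' a) w := by
    simp [hj, hij]
  refine ⟨?_, fun f hf => ?_, fun c hc => ?_⟩
  · rintro (a | a) <;> rw [h.mem_splineModule_iff] <;> simp only [Sum.elim_inl, Sum.elim_inr]
    · simp only [hi, hij]
      exact ⟨hb.mem a, zero_mem _⟩
    · simp only [hj, hji]
      exact ⟨zero_mem _, hb'.mem a⟩
  · obtain ⟨h1, h2⟩ := h.mem_splineModule_iff.1 hf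
    obtain ⟨c, hc⟩ := hb.exists_eq_sum _ h1
    obtain ⟨c', hc'⟩ := hb'.exists_eq_sum _ h2
    exact ⟨Sum.elim c c', h.funext (fun v => (congrFun hc v).trans (hsum (Sum.elim c c') v).symm)
      fun w => (congrFun hc' w).trans (hsum' (Sum.elim c c') w).symm⟩
  · have h1 := hb.eq_zero (fun a => c (Sum.inl a)) (_root_.funext fun v => by
      rw [← hsum, hc]; rfl)
    have h2 := hb'.eq_zero (fun a => c (Sum.inr a)) (_root_.funext fun w => by
      rw [← hsum', hc]; rfl)
    funext a
    rcases a with a | a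
    · exact congrFun h1 a
    · exact congrFun h2 a

/-- The splines on a vertex identification. -/
theorem isSplineBasis_of_inter_singleton {g : V} {g' : W} (hg : ∀ v w, i v = j w ↔ v = g ∧ w = g')
    {I J : Type*} [Fintype I] [Fintype J] {b : I → V → R} {b' : J → W → R}
    (hb : IsSplineBasis G (fun v => z (i v)) fun o : Option I => o.elim 1 b)
    (hb' : IsSplineBasis H (fun w => z (j w)) fun o : Option J => o.elim 1 b')
    (hbg : ∀ a, b a g = 0) (hbg' : ∀ a, b' a g' = 0) :
    IsSplineBasis Γ z fun o : Option (I ⊕ J) => o.elim 1 (Sum.elim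
      (fun a => Function.extend i (b a) 0) fun a => Function.extend j (b' a) 0) := by
  have hgg : i g = j g' := (hg g g').2 ⟨rfl, rfl⟩
  have hi (f : V → R) (v : V) : Function.extend i f 0 (i v) = f v :=
    h.injective_left.extend_apply _ _ _
  have hj (f : W → R) (w : W) : Function.extend j f 0 (j w) = f w :=
    h.injective_right.extend_apply _ _ _
  -- Since `b a` vanishes at the glued vertex, its extension by zero vanishes on all of `H`, hence
  -- is a spline there.
  have hij (a : I) (w : W) : Function.extend i (b a) 0 (j w) = 0 := by
    by_cases hw : w = g'
    · rw [hw, ← hgg, hi, hbg]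
    · exact Function.extend_apply' _ _ _ fun ⟨v, hv⟩ => hw ((hg v w).1 hv).2
  have hji (a : J) (v : V) : Function.extend j (b' a) 0 (i v) = 0 := by
    by_cases hv : v = g
    · rw [hv, hgg, hj, hbg']
    · exact Function.extend_apply' _ _ _ fun ⟨w, hw⟩ => hv ((hg v w).1 hw.symm).1
  have hsum (c : Option (I ⊕ J) → R) (v : V) :
      (∑ a, c a • a.elim 1 (Sum.elim (fun a => Function.extend i (b a) 0)
        (fun a => Function.extend j (b' a) 0))) (i v) =
      (∑ a : Option I, c (a.map Sum.inl) • a.elim 1 b) v := by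
    simp [Fintype.sum_option, hi, hji]
  have hsum' (c : Option (I ⊕ J) → R) (w : W) :
      (∑ a, c a • a.elim 1 (Sum.elim (fun a => Function.extend i (b a) 0)
        (fun a => Function.extend j (b' a) 0))) (j w) =
      (∑ a : Option J, c (a.map Sum.inr) • a.elim 1 b') w := by
    simp [Fintype.sum_option, hj, hij]
  have hval (c : Option I → R) : (∑ a, c a • a.elim 1 b) g = c none := by
    simp [Fintype.sum_option, hbg]
  have hval' (c : Option J → R) : (∑ a, c a • a.elim 1 b') g' = c none := by
    simp [Fintype.sum_option, hbg']
  refine ⟨?_, fun f hf => ?_, fun c hc => ?_⟩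
  · rintro (_ | a | a)
    · exact const_mem_splineModule z 1
    all_goals
      rw [h.mem_splineModule_iff]
      simp only [Option.elim_some, Sum.elim_inl, Sum.elim_inr, hi, hj, hij, hji]
    · exact ⟨hb.mem (some a), zero_mem _⟩
    · exact ⟨zero_mem _, hb'.mem (some a)⟩
  · obtain ⟨h1, h2⟩ := h.mem_splineModule_iff.1 hf
    obtain ⟨c, hc⟩ := hb.exists_eq_sum _ h1
    obtain ⟨c', hc'⟩ := hb'.exists_eq_sum _ h2
    -- Both coefficients of `1` are the value of `f` at the shared vertex.
    have h3 : c none = c' none := by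
      rw [← hval c, ← hval' c', ← hc, ← hc']
      exact congrArg f hgg
    refine ⟨fun o => o.elim (c none) (Sum.elim (fun a => c (some a)) fun a => c' (some a)),
      h.funext (fun v => (congrFun hc v).trans (Eq.trans ?_ (hsum _ v).symm))
      fun w => (congrFun hc' w).trans (Eq.trans ?_ (hsum' _ w).symm)⟩
    · simp [Fintype.sum_option]
    · simp [Fintype.sum_option, h3]
  · have h1 := hb.eq_zero (fun a => c (a.map Sum.inl)) (_root_.funext fun v => by
      rw [← hsum, hc]; rfl)
    have h2 := hb'.eq_zero (fun a => c (a.map Sum.inr)) (_root_.funext fun w => by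
      rw [← hsum', hc]; rfl)
    funext a
    rcases a with _ | a | a
    · exact congrFun h1 none
    · exact congrFun h1 (some a)
    · exact congrFun h2 (some a)

end IsGraphUnion

variable {K : Type*} [Field K] {N : Type*} [AddCommGroup N] [Module K N]

theorem Function.extend_zero_mem {A B R S : Type*} [Zero R] [SetLike S R] [ZeroMemClass S R]
    (s : S) {i : A → B} (hi : Function.Injective i) {f : A → R} (hf : ∀ a, f a ∈ s) (b : B) :
    Function.extend i f 0 b ∈ s := by
  by_cases h : ∃ a, i a = b
  · obtain ⟨a, rfl⟩ := h
    rw [hi.extend_apply]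
    exact hf a
  · rw [Function.extend_apply' _ _ _ h]
    exact zero_mem s

theorem IsGraphUnion.isSplineFree_of_disjoint (h : IsGraphUnion Γ G H i j)
    (hd : ∀ v w, i v ≠ j w) {z : U → N} {s t : Multiset ℕ}
    (hG : IsSplineFree K G (fun v => z (i v)) s) (hH : IsSplineFree K H (fun w => z (j w)) t) :
    IsSplineFree K Γ z (s + t) := by
  obtain ⟨n, b, d, hb, hbd, rfl⟩ := hG
  obtain ⟨m, b', d', hb', hbd', rfl⟩ := hH
  refine IsSplineFree.intro (Sum.elim d d')
    (h.isSplineBasis_of_disjoint (z := fun u => SymmetricAlgebra.ι K N (z u)) hd hb hb') ?_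
    (by simp)
  rintro (a | a) u
  · exact Function.extend_zero_mem _ h.injective_left (hbd a) u
  · exact Function.extend_zero_mem _ h.injective_right (hbd' a) u

theorem IsGraphUnion.isSplineFree_of_inter_singleton [Finite V] [Finite W]
    (h : IsGraphUnion Γ G H i j) {g : V} {g' : W} (hg : ∀ v w, i v = j w ↔ v = g ∧ w = g')
    {z : U → N} {r s t : Multiset ℕ} (hG : IsSplineFree K G (fun v => z (i v)) s)
    (hH : IsSplineFree K H (fun w => z (j w)) t) (hr : 0 ::ₘ r = s + t) :
    IsSplineFree K Γ z r := by
  obtain ⟨I, _, b, d, hb, hbd, hbg, rfl⟩ := hG.exists_one g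
  obtain ⟨J, _, b', d', hb', hbd', hbg', rfl⟩ := hH.exists_one g'
  refine IsSplineFree.intro (fun o : Option (I ⊕ J) => o.elim 0 (Sum.elim d d'))
    (h.isSplineBasis_of_inter_singleton (z := fun u => SymmetricAlgebra.ι K N (z u))
      hg hb hb' hbg hbg') ?_ ?_
  · rintro (_ | a | a) u
    · simp
    · exact Function.extend_zero_mem _ h.injective_left (hbd a) u
    · exact Function.extend_zero_mem _ h.injective_right (hbd' a) u
  · rw [Multiset.cons_add, Multiset.add_cons, Multiset.cons_inj_right] at hr
    rw [hr]
    simp [Fintype.sum_option]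

/-- The edges at the new vertex say that `f (some v) = f none + δ (some v) * k v` with a unique `k`.
The label `δ (some v)` is coprime to the labels of the edges of `G` at `v`, so the remaining
conditions say that `k` is a spline on `G`. Multiplication by `δ` raises degrees by one. -/
theorem IsSplineFree.addDominating {y : Option V → N}
    (hy : y none ∉ Submodule.span K (Set.range fun v => y (some v))) {s : Multiset ℕ}
    (h : IsSplineFree K G (fun v => y (some v)) s) :
    IsSplineFree K G.addDominating y (0 ::ₘ s.map (· + 1)) := by
  obtain ⟨n, b, d, hb, hd, rfl⟩ := h
  let δ : Option V → SymmetricAlgebra K N := fun o =>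
    SymmetricAlgebra.ι K N (y o) - SymmetricAlgebra.ι K N (y none)
  have hδ (v : V) : δ (some v) ≠ 0 := by
    simp only [δ, ← map_sub, Ne, map_eq_zero_iff _ SymmetricAlgebra.ι_injective, sub_eq_zero]
    intro h
    exact hy (h ▸ Submodule.subset_span ⟨v, rfl⟩)
  have hcop (v w : V) (f : SymmetricAlgebra K N)
      (h : SymmetricAlgebra.ι K N (y (some v)) - SymmetricAlgebra.ι K N (y (some w)) ∣
        δ (some v) * f) :
      SymmetricAlgebra.ι K N (y (some v)) - SymmetricAlgebra.ι K N (y (some w)) ∣ f := by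
    simp only [δ, ← map_sub] at h ⊢
    -- If `y (some v) - y none` were a multiple of `y (some v) - y (some w)`, then `y none` would
    -- lie in the span of the other vectors.
    refine SymmetricAlgebra.dvd_of_ι_dvd_ι_mul (fun hm => hy ?_) h
    have hv (v : V) : y (some v) ∈ Submodule.span K (Set.range fun v => y (some v)) :=
      Submodule.subset_span ⟨v, rfl⟩
    have h1 := Submodule.span_singleton_le_iff_mem _ _ |>.2 (sub_mem (hv v) (hv w)) hm
    simpa using sub_mem (hv v) h1
  have hb1 (c : Option (Fin n) → SymmetricAlgebra K N) :
      (∑ a : Option (Fin n), c a • a.elim (1 : Option V → SymmetricAlgebra K N)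
        fun a o => δ o * o.elim 0 (b a)) none = c none := by
    simp [Fintype.sum_option]
  have hb2 (c : Option (Fin n) → SymmetricAlgebra K N) (v : V) :
      (∑ a : Option (Fin n), c a • a.elim (1 : Option V → SymmetricAlgebra K N)
        fun a o => δ o * o.elim 0 (b a)) (some v) =
      c none + δ (some v) * (∑ a, c (some a) • b a) v := by
    simp only [Fintype.sum_option, Option.elim_none, Option.elim_some, Pi.smul_apply,
      Finset.sum_apply, Pi.one_apply, smul_eq_mul, mul_one, Finset.mul_sum]
    congr 1
    exact Finset.sum_congr rfl fun _ _ => by ring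
  refine IsSplineFree.intro (fun o : Option (Fin n) => o.elim 0 fun a => d a + 1)
    (b := fun a => a.elim 1 fun a o => δ o * o.elim 0 (b a)) ⟨?_, fun f hf => ?_, fun c hc => ?_⟩
    ?_ ?_
  · rintro (_ | a)
    · exact const_mem_splineModule _ 1
    · rintro (_ | v) (_ | w) hvw
      · simp
      · simp only [Option.elim_some, Option.elim_none, mul_zero, zero_sub, dvd_neg]
        rw [← dvd_neg, ← neg_mul, neg_sub]
        exact dvd_mul_right _ _
      · simp only [Option.elim_some, Option.elim_none, mul_zero, sub_zero]
        exact dvd_mul_right _ _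
      · have h1 := hb.mem a v w hvw
        simp only [Option.elim_some]
        have h2 : δ (some v) * b a v - δ (some w) * b a w = δ (some v) * (b a v - b a w) +
            (SymmetricAlgebra.ι K N (y (some v)) - SymmetricAlgebra.ι K N (y (some w))) * b a w := by
          simp only [δ]
          ring
        rw [h2]
        exact dvd_add (h1.mul_left _) (dvd_mul_right _ _)
  · choose k hk using fun v : V => hf (some v) none trivial
    have hk' (v : V) : f (some v) - f none = δ (some v) * k v := hk v
    have hmem : k ∈ splineModule G fun v => SymmetricAlgebra.ι K N (y (some v)) := by
      intro v w hvw
      refine hcop v w _ ?_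
      have h1 := hf (some v) (some w) hvw
      have h2 : δ (some v) * (k v - k w) = (f (some v) - f (some w)) -
          (SymmetricAlgebra.ι K N (y (some v)) - SymmetricAlgebra.ι K N (y (some w))) * k w := by
        have h3 := hk' v
        have h4 := hk' w
        simp only [δ] at h3 h4 ⊢
        linear_combination -h3 + h4
      rw [h2]
      exact dvd_sub h1 (dvd_mul_right _ _)
    obtain ⟨c, hc⟩ := hb.exists_eq_sum k hmem
    refine ⟨fun o => o.elim (f none) c, funext fun o => ?_⟩
    rcases o with _ | v
    · rw [hb1]
      rfl
    · rw [hb2]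
      simp only [Option.elim_none, Option.elim_some]
      rw [← hc, ← hk']
      ring
  · have h1 : c none = 0 := by rw [← hb1 c, hc]; rfl
    have h2 := hb.eq_zero (fun a => c (some a)) (funext fun v => by
      have h3 := hb2 c v
      rw [hc, h1, zero_add] at h3
      exact (mul_eq_zero.1 h3.symm).resolve_left (hδ v))
    funext o
    rcases o with _ | a
    · exact h1
    · exact congrFun h2 a
  · rintro (_ | a) o
    · simp
    · simp only [Option.elim_some, δ, ← map_sub]
      rw [pow_succ']
      refine Submodule.mul_mem_mul ⟨_, rfl⟩ ?_
      rcases o with _ | v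
      · exact zero_mem _
      · exact hd a v
  · simp only [Fintype.sum_option, Option.elim_none, Option.elim_some, Multiset.singleton_add]
    congr 1
    change _ = Multiset.mapAddMonoidHom (· + 1) (∑ i, {d i})
    rw [map_sum]
    simp

/-- The splines on `G + v` if the labels of the edges of `G` vanish. -/
theorem isSplineFree_addDominating_of_forall_adj_eq [Finite V] {y : Option V → N}
    (hy : ∀ v w, G.Adj v w → y (some v) = y (some w))
    (hf : ∀ f ∈ splineModule G.addDominating (fun o => SymmetricAlgebra.ι K N (y o)),
      ∀ o o', y o = y o' → f o = f o') :
    IsSplineFree K G.addDominating y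
      (0 ::ₘ Multiset.replicate (Nat.card (Set.range y) - 1) 1) := by
  classical
  have := Fintype.ofFinite V
  -- The members of the basis other than `1` are indexed by the values of `y` different from `y
  -- none`: the member for `p` is supported on the fibre over `p`, where it equals the label `p - y
  -- none`.
  let I := {p : Set.range y // p ≠ ⟨y none, none, rfl⟩}
  have hcard : Fintype.card I = Nat.card (Set.range y) - 1 := by
    rw [Nat.card_eq_fintype_card]
    simp [I]
  have hex (p : I) : ∃ v, y (some v) = p.1.1 := by
    obtain ⟨⟨_, o, rfl⟩, hp⟩ := p
    rcases o with _ | v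
    · exact (hp rfl).elim
    · exact ⟨v, rfl⟩
  choose rep hrep using hex
  have hne (p : I) : p.1.1 ≠ y none := fun h => p.2 (Subtype.ext h)
  let b : Option I → Option V → SymmetricAlgebra K N := fun a => a.elim 1 fun p o =>
    if y o = p.1.1 then SymmetricAlgebra.ι K N p.1.1 - SymmetricAlgebra.ι K N (y none) else 0
  have hb1 (c : Option I → SymmetricAlgebra K N) (o : Option V) (ho : y o = y none) :
      (∑ a, c a • b a) o = c none := by
    simp [Fintype.sum_option, b, ho, (hne _).symm]
  have hb2 (c : Option I → SymmetricAlgebra K N) (o : Option V) (p : I) (hp : y o = p.1.1) :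
      (∑ a, c a • b a) o = c none +
        c (some p) * (SymmetricAlgebra.ι K N p.1.1 - SymmetricAlgebra.ι K N (y none)) := by
    have (q : I) : p.1.1 = q.1.1 ↔ p = q := by rw [Subtype.ext_iff, Subtype.ext_iff]
    simp only [Fintype.sum_option, b, hp, this, Option.elim_none, Option.elim_some, Pi.smul_apply,
      Finset.sum_apply, Pi.one_apply, smul_eq_mul, mul_one]
    rw [Finset.sum_eq_single p (fun q _ hq => by rw [if_neg hq.symm, mul_zero])
      (fun h => (h (Finset.mem_univ p)).elim), if_pos rfl]
  refine IsSplineFree.intro (fun o : Option I => o.elim 0 fun _ => 1)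
    (b := b) ⟨?_, fun f hmem => ?_, fun c hc => ?_⟩ ?_ ?_
  · rintro (_ | p)
    · exact const_mem_splineModule _ 1
    · have key (v : V) : SymmetricAlgebra.ι K N (y (some v)) - SymmetricAlgebra.ι K N (y none) ∣
          b (some p) (some v) - b (some p) none := by
        have h1 : b (some p) none = 0 := by simp [b, (hne p).symm]
        rw [h1, sub_zero]
        by_cases h : y (some v) = p.1.1
        · simp [b, h]
        · simp [b, h]
      rintro (_ | v) (_ | w) hvw
      · simp
      · rw [dvd_sub_comm, ← neg_sub, neg_dvd]
        exact key w
      · exact key v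
      · have h1 := hy v w hvw
        simp [b, h1]
  · choose k hk using fun v : V => hmem (some v) none trivial
    refine ⟨fun o => o.elim (f none) fun p => k (rep p), funext fun o => ?_⟩
    by_cases ho : y o = y none
    · rw [hb1 _ _ ho]
      exact hf f hmem _ _ ho
    · let p : I := ⟨⟨y o, o, rfl⟩, fun h => ho (congrArg Subtype.val h)⟩
      rw [hb2 _ _ p rfl]
      have h1 := hk (rep p)
      rw [hf f hmem _ _ (hrep p : _ = y o)] at h1
      simp only [hrep p] at h1
      simp only [Option.elim_none, Option.elim_some]
      linear_combination h1
  · have h1 : c none = 0 := by rw [← hb1 c none rfl, hc]; rfl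
    funext a
    rcases a with _ | p
    · exact h1
    · have h2 := hb2 c _ p (hrep p)
      rw [hc, h1, zero_add] at h2
      refine (mul_eq_zero.1 h2.symm).resolve_right ?_
      rw [← map_sub, map_eq_zero_iff _ SymmetricAlgebra.ι_injective, sub_eq_zero]
      exact hne p
  · rintro (_ | p) o
    · simp [b]
    · simp only [b, Option.elim_some, pow_one]
      split_ifs
      · rw [← map_sub]
        exact ⟨_, rfl⟩
      · exact zero_mem _
  · rw [← hcard]
    simp [Fintype.sum_option, Multiset.nsmul_singleton]

end Operations

/-! ### Multisets of degrees -/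

theorem Multiset.count_sum_singleton {I A : Type*} [Fintype I] [DecidableEq A] (f : I → A) (a : A) :
    Multiset.count a (∑ i, {f i}) = Fintype.card {i // f i = a} := by
  rw [Multiset.count_sum', Fintype.card_subtype, Finset.card_filter]
  exact Finset.sum_congr rfl fun i _ => by rw [Multiset.count_singleton]; simp only [eq_comm]

/-- Equal multiplicities mean equinumerous fibres over each value; this recovers a degree-preserving
reindexing of a basis from a multiset of degrees. -/
theorem Fintype.exists_equiv_of_sum_singleton_eq {I J A : Type*} [Fintype I] [Fintype J]
    {f : I → A} {g : J → A} (h : ∑ i, ({f i} : Multiset A) = ∑ j, {g j}) :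
    ∃ e : J ≃ I, ∀ j, f (e j) = g j := by
  classical
  have hfib (a : A) : Nonempty ({j // g j = a} ≃ {i // f i = a}) := by
    rw [← Fintype.card_eq, ← Multiset.count_sum_singleton g, ← Multiset.count_sum_singleton f, h]
  exact ⟨Equiv.ofFiberEquiv fun a => (hfib a).some, fun j => Equiv.ofFiberEquiv_map _ j⟩

theorem List.sum_singleton_get (e : List ℕ) :
    ∑ i, ({e.get i} : Multiset ℕ) = (e : Multiset ℕ) := by
  have h : ∑ i, ({e.get i} : Multiset ℕ) = Finset.univ.val.map e.get := by
    rw [← Multiset.sum_map_singleton (Finset.univ.val.map e.get), Multiset.map_map]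
    rfl
  rw [h, Fin.univ_val_map, List.ofFn_get]

/-! ### Derivations of symmetric algebras -/

namespace SymmetricAlgebra

variable {K M : Type*} [Field K] [AddCommGroup M] [Module K M]

/-- A linear map `M → S(M)` extends to a derivation of `S(M)`. -/
theorem exists_derivation (L : M →ₗ[K] SymmetricAlgebra K M) :
    ∃ θ : Derivation K (SymmetricAlgebra K M) (SymmetricAlgebra K M),
      ∀ x, θ (ι K M x) = L x := by
  let b := Basis.ofVectorSpace K M
  let e := equivMvPolynomial b
  let D := MvPolynomial.mkDerivation K fun i => e (L (b i))
  let θ : Derivation K (SymmetricAlgebra K M) (SymmetricAlgebra K M) :=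
    Derivation.mk' (e.symm.toLinearMap ∘ₗ D.toLinearMap ∘ₗ e.toLinearMap) fun f g => by
      simp [Derivation.leibniz]
  refine ⟨θ, fun x => ?_⟩
  have h : θ.toLinearMap ∘ₗ ι K M = L := b.ext fun i => by
    change e.symm (D (e (ι K M (b i)))) = L (b i)
    rw [equivMvPolynomial_ι_apply, MvPolynomial.mkDerivation_X, AlgEquiv.symm_apply_apply]
  exact LinearMap.congr_fun h x

theorem derivation_ext {θ η : Derivation K (SymmetricAlgebra K M) (SymmetricAlgebra K M)}
    (h : ∀ x, θ (ι K M x) = η (ι K M x)) : θ = η := by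
  ext f
  induction f using SymmetricAlgebra.induction with
  | algebraMap r => simp
  | ι x => exact h x
  | mul a b ha hb => rw [Derivation.leibniz, Derivation.leibniz, ha, hb]
  | add a b ha hb => rw [map_add, map_add, ha, hb]

end SymmetricAlgebra

/-! ### The derivation module in terms of single hyperplanes -/

namespace CentralArrangement

section DerivationModule

variable {K V : Type*} [Field K] [AddCommGroup V] [Module K V] (A : CentralArrangement K V)

theorem exists_smul_of_ker_eq {α β : Dual K V} (h : LinearMap.ker α = LinearMap.ker β) :
    ∃ c : K, β = c • α := by
  by_cases hα : α = 0
  · refine ⟨0, ?_⟩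
    rw [hα, LinearMap.ker_zero, eq_comm, LinearMap.ker_eq_top] at h
    rw [h, zero_smul]
  · obtain ⟨v, hv⟩ : ∃ v, α v ≠ 0 := by
      by_contra! h0
      exact hα (LinearMap.ext h0)
    refine ⟨β v / α v, LinearMap.ext fun w => ?_⟩
    have h1 : α w • v - α v • w ∈ LinearMap.ker β := by
      rw [← h]
      simp [mul_comm]
    have h2 : α w * β v - α v * β w = 0 := by simpa using h1
    rw [LinearMap.smul_apply, smul_eq_mul]
    field_simp
    linear_combination -h2

theorem dvd_derivation_prod {S I : Type*} [CommRing S] [Algebra K S] (θ : Derivation K S S)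
    (s : Finset I) (a : I → S) (h : ∀ i ∈ s, a i ∣ θ (a i)) : ∏ i ∈ s, a i ∣ θ (∏ i ∈ s, a i) := by
  classical
  induction s using Finset.induction_on with
  | empty => simp
  | insert i s hi ih =>
    rw [Finset.prod_insert hi, Derivation.leibniz, smul_eq_mul, smul_eq_mul, mul_comm (∏ _ ∈ s, _)]
    exact dvd_add (mul_dvd_mul_left _ (ih fun j hj => h j (Finset.mem_insert_of_mem hj)))
      (mul_dvd_mul_right (h i (Finset.mem_insert_self i s)) _)

/-- A derivation lies in `D(A)` if and only if it preserves the ideal of each hyperplane. -/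
theorem mem_derivationModule_iff
    {θ : Derivation K (SymmetricAlgebra K (Dual K V)) (SymmetricAlgebra K (Dual K V))} :
    θ ∈ A.derivationModule ↔ ∀ α : Dual K V, LinearMap.ker α ∈ A.hyperplanes →
      SymmetricAlgebra.ι K _ α ∣ θ (SymmetricAlgebra.ι K _ α) := by
  classical
  have hmem : θ ∈ A.derivationModule ↔ A.definingPoly ∣ θ A.definingPoly :=
    Ideal.mem_span_singleton
  rw [hmem]
  constructor
  · intro h α hα
    set H := LinearMap.ker α with hH
    have hker := ker_form (A.isCoatom H hα)
    obtain ⟨c, hc⟩ := exists_smul_of_ker_eq (hker.trans hH)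
    have hform : form H ≠ 0 := by
      intro h0
      rw [h0, LinearMap.ker_zero] at hker
      exact (A.isCoatom H hα).1 hker.symm
    have hp := SymmetricAlgebra.prime_ι (K := K) hform
    suffices hs : SymmetricAlgebra.ι K (Dual K V) (form H) ∣
        θ (SymmetricAlgebra.ι K (Dual K V) (form H)) by
      have hc0 : c ≠ 0 := by
        rintro rfl
        rw [zero_smul] at hc
        rw [hc, LinearMap.ker_zero] at hH
        exact (A.isCoatom H hα).1 hH
      obtain ⟨k, hk⟩ := hs
      refine ⟨k, ?_⟩
      rw [hc, map_smul, Derivation.map_smul, hk, smul_mul_assoc]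
    have hprod : A.definingPoly = SymmetricAlgebra.ι K _ (form H) *
        ∏ H' ∈ A.finite.toFinset.erase H, SymmetricAlgebra.ι K _ (form H') :=
      (Finset.mul_prod_erase _ _ (A.finite.mem_toFinset.2 hα)).symm
    have h1 := (Dvd.intro _ hprod.symm).trans h
    rw [hprod, Derivation.leibniz, smul_eq_mul, smul_eq_mul] at h1
    -- With `Q = α * Q'`, the Leibniz rule shows that `α` divides `Q' * θ α`. The prime `α` does not
    -- divide `Q'`, since forms of distinct hyperplanes are not proportional.
    refine (hp.dvd_or_dvd ((dvd_add_right (dvd_mul_right _ _)).1 h1)).resolve_left fun h2 => ?_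
    obtain ⟨H', hH', hd⟩ := hp.exists_mem_finset_dvd h2
    obtain ⟨hne, hmem'⟩ := Finset.mem_erase.1 hH'
    have hker' := ker_form (A.isCoatom H' (A.finite.mem_toFinset.1 hmem'))
    obtain ⟨a, ha⟩ := Submodule.mem_span_singleton.1 (SymmetricAlgebra.mem_span_of_ι_dvd_ι hd)
    have ha0 : a ≠ 0 := by
      rintro rfl
      rw [zero_smul] at ha
      rw [← ha, LinearMap.ker_zero] at hker'
      exact (A.isCoatom H' (A.finite.mem_toFinset.1 hmem')).1 hker'.symm
    rw [← ha, LinearMap.ker_smul _ _ ha0, hker] at hker'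
    exact hne hker'.symm
  · intro h
    refine dvd_derivation_prod θ _ _ fun H hH => h _ ?_
    have hmem := A.finite.mem_toFinset.1 hH
    rwa [ker_form (A.isCoatom H hmem)]

end DerivationModule

end CentralArrangement

/-! ### Derivations as splines -/

section Bridge

/-- The coordinates of a linear map to `K^V`. -/
def LinearMap.coordForm {K V Y : Type*} [Field K] [AddCommGroup Y] [Module K Y]
    (p : Y →ₗ[K] V → K) (v : V) : Dual K Y :=
  LinearMap.proj v ∘ₗ p

@[simp]
theorem LinearMap.coordForm_apply {K V Y : Type*} [Field K] [AddCommGroup Y] [Module K Y]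
    (p : Y →ₗ[K] V → K) (v : V) (y : Y) : p.coordForm v y = p y v := rfl

variable {K : Type*} [Field K] {V : Type*} [Finite V] {G : SimpleGraph V}
  {Y : Type*} [AddCommGroup Y] [Module K Y] {p : Y →ₗ[K] V → K} {r : V → V → Prop}

theorem LinearMap.mem_span_of_comp_eq_zero
    (hp : ∀ x, x ∈ LinearMap.range p ↔ ∀ v w, r v w → x v = x w)
    {φ : Dual K (V → K)} (hφ : φ ∘ₗ p = 0) :
    φ ∈ Submodule.span K (Set.range fun q : {q : V × V // r q.1 q.2} =>
      (LinearMap.id : (V → K) →ₗ[K] V → K).coordForm q.1.1 -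
        (LinearMap.id : (V → K) →ₗ[K] V → K).coordForm q.1.2) := by
  refine FiniteDimensional.mem_span_of_iInf_ker_le_ker fun x hx => ?_
  obtain ⟨y, rfl⟩ := (hp x).2 fun v w h => by
    simpa [sub_eq_zero] using (Submodule.mem_iInf _).1 hx ⟨(v, w), h⟩
  exact LinearMap.congr_fun hφ y

/-- The relations among the coordinate forms on `Y` are spanned by the differences along `r`, so
values that respect `r` extend linearly to the dual of `Y`. -/
theorem LinearMap.exists_apply_proj_comp_eq (hinj : Function.Injective p)
    (hp : ∀ x, x ∈ LinearMap.range p ↔ ∀ v w, r v w → x v = x w)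
    {R : Type*} [AddCommGroup R] [Module K R] {f : V → R} (hf : ∀ v w, r v w → f v = f w) :
    ∃ L : Dual K Y →ₗ[K] R, ∀ v, L (p.coordForm v) = f v := by
  classical
  have := Fintype.ofFinite V
  let T : Dual K (V → K) →ₗ[K] R := (Pi.basisFun K V).dualBasis.constr K f
  have hT (v : V) : T ((LinearMap.id : (V → K) →ₗ[K] V → K).coordForm v) = f v := by
    have h1 : (LinearMap.id : (V → K) →ₗ[K] V → K).coordForm v = (Pi.basisFun K V).dualBasis v := by
      ext w
      simp
    rw [h1, Basis.constr_basis]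
  have hker (φ : Dual K (V → K)) (hφ : φ ∘ₗ p = 0) : T φ = 0 := by
    have h1 := LinearMap.mem_span_of_comp_eq_zero hp hφ
    refine LinearMap.mem_ker.1 (Submodule.span_le.2 ?_ h1)
    rintro _ ⟨⟨⟨v, w⟩, h⟩, rfl⟩
    simp [hT, hf v w h]
  obtain ⟨g, hg⟩ := (p.dualMap).exists_rightInverse_of_surjective
    (LinearMap.range_eq_top.2 (LinearMap.dualMap_surjective_of_injective hinj))
  refine ⟨T ∘ₗ g, fun v => ?_⟩
  rw [LinearMap.comp_apply, ← hT v, ← sub_eq_zero, ← map_sub]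
  refine hker _ ?_
  rw [LinearMap.sub_comp, sub_eq_zero]
  exact LinearMap.congr_fun hg (p.coordForm v)

theorem LinearMap.span_range_proj_comp (hinj : Function.Injective p) :
    Submodule.span K (Set.range fun v => p.coordForm v) = ⊤ := by
  rw [eq_top_iff]
  have : FiniteDimensional K Y := FiniteDimensional.of_injective p hinj
  intro φ _
  refine FiniteDimensional.mem_span_of_iInf_ker_le_ker fun y hy => ?_
  have : y = 0 := hinj (funext fun v => by simpa using (Submodule.mem_iInf _).1 hy v)
  rw [this]
  exact zero_mem _

variable {A : CentralArrangement K Y}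

/-- The coefficient vectors of the derivations of an arrangement that is cut out by the
differences of the coordinate functions along the edges of `G` are the splines on `G`. -/
noncomputable def CentralArrangement.derivationModuleEquiv (hinj : Function.Injective p)
    (hp : ∀ x, x ∈ LinearMap.range p ↔ ∀ v w, r v w → x v = x w)
    (hr : ∀ v w, r v w → G.Adj v w)
    (hA : ∀ H, H ∈ A.hyperplanes ↔ ∃ v w, G.Adj v w ∧
      p.coordForm v ≠ p.coordForm w ∧
      H = LinearMap.ker (p.coordForm v - p.coordForm w)) :
    A.derivationModule ≃ₗ[SymmetricAlgebra K (Dual K Y)]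
      splineModule G fun v => SymmetricAlgebra.ι K _ (p.coordForm v) := by
  let Φ : A.derivationModule →ₗ[SymmetricAlgebra K (Dual K Y)]
      splineModule G fun v => SymmetricAlgebra.ι K _ (p.coordForm v) :=
    { toFun := fun θ => ⟨fun v => θ.1 (SymmetricAlgebra.ι K _ (p.coordForm v)), by
        intro v w hvw
        rw [← map_sub, ← map_sub, ← map_sub]
        -- An edge whose forms agree on `Y` gives no hyperplane, but its spline condition reads `0 ∣
        -- 0`.
        by_cases h : p.coordForm v = p.coordForm w
        · simp [h]
        · exact A.mem_derivationModule_iff.1 θ.2 _ ((hA _).2 ⟨v, w, hvw, h, rfl⟩)⟩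
      map_add' := fun _ _ => rfl
      map_smul' := fun _ _ => rfl }
  refine LinearEquiv.ofBijective Φ ⟨?_, ?_⟩
  · intro θ η h
    refine Subtype.ext (SymmetricAlgebra.derivation_ext fun α => ?_)
    have hα : α ∈ Submodule.span K (Set.range fun v => p.coordForm v) := by
      rw [LinearMap.span_range_proj_comp hinj]
      trivial
    induction hα using Submodule.span_induction with
    | mem x hx =>
      obtain ⟨v, rfl⟩ := hx
      exact congrFun (congrArg Subtype.val h) v
    | zero => simp
    | add x y _ _ hx hy => simp only [map_add, hx, hy]
    | smul c x _ hx => simp only [map_smul, Derivation.map_smul, hx]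
  · rintro ⟨f, hf⟩
    -- Contracted edges have label `0`, so `f` respects `r` and extends to a derivation.
    have hf' (v w : V) (h : r v w) : f v = f w := by
      have h0 : p.coordForm v = p.coordForm w :=
        LinearMap.ext fun y => (hp _).1 ⟨y, rfl⟩ v w h
      have h1 := hf v w (hr v w h)
      simp only [h0] at h1
      rwa [sub_self, zero_dvd_iff, sub_eq_zero] at h1
    obtain ⟨L, hL⟩ := LinearMap.exists_apply_proj_comp_eq hinj hp hf'
    obtain ⟨θ, hθ⟩ := SymmetricAlgebra.exists_derivation L
    refine ⟨⟨θ, A.mem_derivationModule_iff.2 fun α hα => ?_⟩, ?_⟩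
    · obtain ⟨v, w, hvw, -, hker⟩ := (hA _).1 hα
      obtain ⟨c, rfl⟩ := CentralArrangement.exists_smul_of_ker_eq hker.symm
      have h1 := hf v w hvw
      rw [map_smul, Derivation.map_smul, map_sub, map_sub, hθ, hθ, hL, hL]
      obtain ⟨k, hk⟩ := h1
      exact ⟨k, by rw [smul_mul_assoc, ← hk]⟩
    · exact Subtype.ext (funext fun v => (hθ _).trans (hL v))

theorem CentralArrangement.derivationModuleEquiv_apply (hinj : Function.Injective p)
    (hp : ∀ x, x ∈ LinearMap.range p ↔ ∀ v w, r v w → x v = x w)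
    (hr : ∀ v w, r v w → G.Adj v w)
    (hA : ∀ H, H ∈ A.hyperplanes ↔ ∃ v w, G.Adj v w ∧
      p.coordForm v ≠ p.coordForm w ∧
      H = LinearMap.ker (p.coordForm v - p.coordForm w))
    (θ : A.derivationModule) (v : V) :
    (A.derivationModuleEquiv hinj hp hr hA θ : V → _) v =
      θ.1 (SymmetricAlgebra.ι K _ (p.coordForm v)) := rfl

/-- Degrees need to be compared only on the coordinate forms, which span the dual of `Y`. That
homogeneous derivations are nonzero is automatic for members of a basis. -/
theorem CentralArrangement.isFreeWithExponents_iff (hinj : Function.Injective p)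
    (hp : ∀ x, x ∈ LinearMap.range p ↔ ∀ v w, r v w → x v = x w)
    (hr : ∀ v w, r v w → G.Adj v w)
    (hA : ∀ H, H ∈ A.hyperplanes ↔ ∃ v w, G.Adj v w ∧
      p.coordForm v ≠ p.coordForm w ∧
      H = LinearMap.ker (p.coordForm v - p.coordForm w))
    (e : List ℕ) :
    A.IsFreeWithExponents e ↔
      IsSplineFree K G (fun v => p.coordForm v) e := by
  let Φ := A.derivationModuleEquiv hinj hp hr hA
  constructor
  · rintro ⟨θ, hθ⟩
    refine ⟨_, _, e.get, (θ.map Φ).isSplineBasis, fun i v => ?_, e.sum_singleton_get⟩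
    exact (hθ i).2 _
  · rintro ⟨n, b, d, hb, hd, hs⟩
    obtain ⟨σ, hσ⟩ := Fintype.exists_equiv_of_sum_singleton_eq (hs.trans e.sum_singleton_get.symm)
    refine ⟨(hb.toBasis.map Φ.symm).reindex σ.symm, fun i => ⟨fun h0 => ?_, fun α => ?_⟩⟩
    · exact Basis.ne_zero _ i (Subtype.ext h0)
    · have hα : α ∈ Submodule.span K (Set.range fun v => p.coordForm v) := by
        rw [LinearMap.span_range_proj_comp hinj]
        trivial
      induction hα using Submodule.span_induction with
      | mem x hx =>
        obtain ⟨v, rfl⟩ := hx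
        rw [← A.derivationModuleEquiv_apply hinj hp hr hA]
        rw [← hσ i]
        simpa [Φ, hb.toBasis_apply] using hd (σ i) v
      | zero => simp
      | add x y _ _ hx hy =>
        simp only [map_add]
        exact add_mem hx hy
      | smul c x _ hx =>
        simp only [map_smul, Derivation.map_smul]
        exact Submodule.smul_mem _ _ hx

end Bridge

/-! ### Flats of graphic arrangements -/

section Flats

theorem mem_edgeHyperplane {K : Type*} [Field K] {V : Type*} {v w : V} {x : V → K} :
    x ∈ edgeHyperplane K v w ↔ x v = x w := by
  simp [edgeHyperplane, sub_eq_zero]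

variable {K : Type*} [Field K] {V : Type*} [Finite V] {G : SimpleGraph V}
  {X : Submodule K (V → K)}

theorem mem_intersectionLattice_graphicArrangement_iff :
    X ∈ (graphicArrangement K G).intersectionLattice ↔
      ∃ r : V → V → Prop, (∀ v w, r v w → G.Adj v w) ∧
        ∀ x, x ∈ X ↔ ∀ v w, r v w → x v = x w := by
  constructor
  · rintro ⟨B, hB, rfl⟩
    refine ⟨fun v w => G.Adj v w ∧ edgeHyperplane K v w ∈ B, fun v w h => h.1, fun x => ?_⟩
    rw [Submodule.mem_sInf]
    constructor
    · intro h v w hvw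
      exact mem_edgeHyperplane.1 (h _ hvw.2)
    · intro h H hH
      obtain ⟨v, w, hvw, rfl⟩ := hB hH
      exact mem_edgeHyperplane.2 (h v w ⟨hvw, hH⟩)
  · rintro ⟨r, hr, hX⟩
    refine ⟨{H | ∃ v w, r v w ∧ H = edgeHyperplane K v w}, ?_, ?_⟩
    · rintro _ ⟨v, w, h, rfl⟩
      exact ⟨v, w, hr v w h, rfl⟩
    · ext x
      rw [hX, Submodule.mem_sInf]
      constructor
      · rintro h _ ⟨v, w, hvw, rfl⟩
        exact mem_edgeHyperplane.2 (h v w hvw)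
      · intro h v w hvw
        exact mem_edgeHyperplane.1 (h _ ⟨v, w, hvw, rfl⟩)

theorem mem_center_graphicArrangement_iff {x : V → K} :
    x ∈ (graphicArrangement K G).center ↔ ∀ v w, G.Adj v w → x v = x w := by
  rw [CentralArrangement.center, Submodule.mem_sInf]
  constructor
  · intro h v w hvw
    exact mem_edgeHyperplane.1 (h _ ⟨v, w, hvw, rfl⟩)
  · rintro h _ ⟨v, w, hvw, rfl⟩
    exact mem_edgeHyperplane.2 (h v w hvw)

theorem center_mem_intersectionLattice :
    (graphicArrangement K G).center ∈ (graphicArrangement K G).intersectionLattice :=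
  ⟨_, subset_rfl, rfl⟩

theorem center_le_of_mem_intersectionLattice
    (hX : X ∈ (graphicArrangement K G).intersectionLattice) :
    (graphicArrangement K G).center ≤ X := by
  obtain ⟨B, hB, rfl⟩ := hX
  exact sInf_le_sInf hB

theorem const_mem_of_mem_intersectionLattice
    (hX : X ∈ (graphicArrangement K G).intersectionLattice) (c : K) : (fun _ => c) ∈ X :=
  center_le_of_mem_intersectionLattice hX
    (mem_center_graphicArrangement_iff.2 fun _ _ _ => rfl)

variable (K G X) in
/-- The splines that describe the restriction of the graphic arrangement to the flat `X` have a
homogeneous basis with degrees `s`. -/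
def IsFlatFree (s : Multiset ℕ) : Prop := IsSplineFree K G X.subtype.coordForm s

/-- The hyperplanes that contain `X`, omitted in the restriction, belong to the edges whose
coordinate forms agree on `X`. -/
theorem isFreeWithExponents_restriction_iff
    (hX : X ∈ (graphicArrangement K G).intersectionLattice) (e : List ℕ) :
    ((graphicArrangement K G).restriction X).IsFreeWithExponents e ↔ IsFlatFree K G X e := by
  obtain ⟨r, hr, hmem⟩ := mem_intersectionLattice_graphicArrangement_iff.1 hX
  refine CentralArrangement.isFreeWithExponents_iff X.injective_subtype
    (by simpa using hmem) hr (fun H => ?_) e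
  have h1 (v w : V) : X ≤ edgeHyperplane K v w ↔
      X.subtype.coordForm v = X.subtype.coordForm w := by
    constructor
    · intro h
      exact LinearMap.ext fun x => mem_edgeHyperplane.1 (h x.2)
    · intro h x hx
      exact mem_edgeHyperplane.2 (LinearMap.congr_fun h ⟨x, hx⟩)
  have h2 (v w : V) : (edgeHyperplane K v w).comap X.subtype =
      LinearMap.ker (X.subtype.coordForm v - X.subtype.coordForm w) := by
    ext x
    simp [mem_edgeHyperplane, sub_eq_zero]
  constructor
  · rintro ⟨_, ⟨v, w, hvw, rfl⟩, hle, rfl⟩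
    exact ⟨v, w, hvw, (h1 v w).not.1 hle, h2 v w⟩
  · rintro ⟨v, w, hvw, hne, rfl⟩
    exact ⟨_, ⟨v, w, hvw, rfl⟩, (h1 v w).not.2 hne, (h2 v w).symm⟩

/-- The arrangement lives on `K^V`, its restriction to `⊤` on a subtype; this identification lets
both be treated as flats. -/
theorem isFlatFree_top_iff {s : Multiset ℕ} : IsFlatFree K G ⊤ s ↔
    IsSplineFree K G (LinearMap.id : (V → K) →ₗ[K] V → K).coordForm s := by
  let e := (Submodule.topEquiv : _ ≃ₗ[K] (V → K))
  exact ⟨fun h => h.map e.symm.toLinearMap.dualMap e.symm.dualMap.injective,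
    fun h => h.map e.toLinearMap.dualMap e.dualMap.injective⟩

theorem isFreeWithExponents_graphicArrangement_iff (e : List ℕ) :
    (graphicArrangement K G).IsFreeWithExponents e ↔ IsFlatFree K G ⊤ e := by
  classical
  rw [isFlatFree_top_iff]
  refine CentralArrangement.isFreeWithExponents_iff (r := fun _ _ => False)
    Function.injective_id (by simp) (fun _ _ h => h.elim) (fun H => ?_) e
  constructor
  · rintro ⟨v, w, hvw, rfl⟩
    refine ⟨v, w, hvw, fun h => ?_, rfl⟩
    simpa [hvw.ne'] using LinearMap.congr_fun h (Pi.single v 1)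
  · rintro ⟨v, w, hvw, -, rfl⟩
    exact ⟨v, w, hvw, rfl⟩

theorem IsFlatFree.card_eq {s : Multiset ℕ} (h : IsFlatFree K G ⊤ s) : s.card = Nat.card V := by
  classical
  have := Fintype.ofFinite V
  rw [Nat.card_eq_fintype_card]
  refine IsSplineFree.card_eq (isFlatFree_top_iff.1 h) fun v w hvw h => ?_
  simpa [hvw.ne'] using LinearMap.congr_fun h (Pi.single v 1)

theorem IsFlatFree.eq_replicate_zero {s : Multiset ℕ}
    (h : IsFlatFree K G (graphicArrangement K G).center s)
    (hs : s.card = finrank K (graphicArrangement K G).center) :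
    s = Multiset.replicate (finrank K (graphicArrangement K G).center) 0 :=
  IsSplineFree.eq_replicate_zero h _ (fun _ => mem_center_graphicArrangement_iff)
    (fun v w hvw => LinearMap.ext fun x => mem_center_graphicArrangement_iff.1 x.2 v w hvw) hs

/-- On a flat, a spline takes equal values at vertices with equal coordinate forms. -/
theorem apply_eq_of_mem_splineModule (hX : X ∈ (graphicArrangement K G).intersectionLattice)
    {f : V → SymmetricAlgebra K (Dual K X)}
    (hf : f ∈ splineModule G fun v => SymmetricAlgebra.ι K _ (X.subtype.coordForm v)) {v w : V}
    (hvw : X.subtype.coordForm v = X.subtype.coordForm w) : f v = f w := by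
  obtain ⟨r, hr, hmem⟩ := mem_intersectionLattice_graphicArrangement_iff.1 hX
  have hf' (v w : V) (h : r v w) : f v = f w := by
    have h0 : X.subtype.coordForm v = X.subtype.coordForm w :=
      LinearMap.ext fun x => (hmem _).1 x.2 v w h
    have h1 := hf v w (hr v w h)
    simp only [h0] at h1
    rwa [sub_self, zero_dvd_iff, sub_eq_zero] at h1
  -- The vertices `v` and `w` need not be related by `r` directly; but `f` factors linearly through
  -- the coordinate forms.
  obtain ⟨L, hL⟩ := LinearMap.exists_apply_proj_comp_eq X.injective_subtype (by simpa using hmem) hf'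
  rw [← hL, ← hL]
  exact congrArg L hvw

/-- The dimension of a flat is the number of distinct coordinate forms. -/
theorem card_range_coordForm (hX : X ∈ (graphicArrangement K G).intersectionLattice) :
    Nat.card (Set.range X.subtype.coordForm) = finrank K X := by
  classical
  have := Fintype.ofFinite V
  obtain ⟨r, hr, hmem⟩ := mem_intersectionLattice_graphicArrangement_iff.1 hX
  -- A point of `X` is an arbitrary function on the classes of vertices with equal coordinate forms.
  let E : X ≃ₗ[K] (Set.range X.subtype.coordForm → K) := LinearEquiv.ofBijective
    { toFun := fun x a => a.1 x
      map_add' := fun x y => funext fun a => map_add a.1 x y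
      map_smul' := fun c x => funext fun a => map_smul a.1 c x } (by
    constructor
    · intro x y hxy
      exact Subtype.ext (funext fun v => congrFun hxy ⟨_, v, rfl⟩)
    · intro c
      refine ⟨⟨fun v => c ⟨_, v, rfl⟩, (hmem _).2 fun v w h => ?_⟩, ?_⟩
      · congr 1
        exact Subtype.ext (LinearMap.ext fun x => (hmem _).1 x.2 v w h)
      · funext ⟨_, v, rfl⟩
        rfl)
  rw [E.finrank_eq, Module.finrank_fintype_fun_eq_card, Nat.card_eq_fintype_card]

/-- Restriction along `i` maps `Z` onto `X`, so the dual of `X` embeds into that of `Z`, and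
extension of scalars to a polynomial ring preserves the basis. -/
theorem IsFlatFree.pullback {U : Type*} {s : Multiset ℕ} (h : IsFlatFree K G X s) (i : V → U)
    {Z : Submodule K (U → K)} (hZ : ∀ z ∈ Z, (fun v => z (i v)) ∈ X)
    (hsurj : ∀ x ∈ X, ∃ z ∈ Z, ∀ v, z (i v) = x v) :
    IsSplineFree K G (fun v => Z.subtype.coordForm (i v)) s := by
  let q : Z →ₗ[K] X := (LinearMap.funLeft K K i).restrict hZ
  have hq : Function.Surjective q := by
    rintro ⟨x, hx⟩
    obtain ⟨z, hz, hzx⟩ := hsurj x hx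
    exact ⟨⟨z, hz⟩, Subtype.ext (funext hzx)⟩
  exact IsSplineFree.map h q.dualMap (LinearMap.dualMap_injective_of_surjective hq)

end Flats

/-! ### Flats of `G + v` -/

section Dominating

variable {K : Type*} [Field K] {V : Type*} {G : SimpleGraph V} {X : Submodule K (V → K)}

/-- The flat of `G + v` that corresponds to a flat `X` of `G`, the coordinate of `v` being free. -/
def coneFlat (X : Submodule K (V → K)) : Submodule K (Option V → K) :=
  X.comap (LinearMap.funLeft K K some)

theorem mem_coneFlat {z : Option V → K} : z ∈ coneFlat X ↔ (fun v => z (some v)) ∈ X := Iff.rfl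

theorem coneFlat_le_coneFlat_iff {X' : Submodule K (V → K)} :
    coneFlat X ≤ coneFlat X' ↔ X ≤ X' := by
  refine ⟨fun h x hx => ?_, fun h => Submodule.comap_mono h⟩
  exact h (x := fun o => o.elim 0 x) hx

variable [Finite V]

theorem coneFlat_mem_intersectionLattice
    (hX : X ∈ (graphicArrangement K G).intersectionLattice) :
    coneFlat X ∈ (graphicArrangement K G.addDominating).intersectionLattice := by
  obtain ⟨r, hr, hmem⟩ := mem_intersectionLattice_graphicArrangement_iff.1 hX
  refine mem_intersectionLattice_graphicArrangement_iff.2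
    ⟨fun o o' => ∃ v w, r v w ∧ o = some v ∧ o' = some w, ?_, fun z => ?_⟩
  · rintro _ _ ⟨v, w, h, rfl, rfl⟩
    exact hr v w h
  · rw [mem_coneFlat, hmem]
    constructor
    · rintro h _ _ ⟨v, w, hvw, rfl, rfl⟩
      exact h v w hvw
    · intro h v w hvw
      exact h _ _ ⟨v, w, hvw, rfl, rfl⟩

theorem finrank_coneFlat : finrank K (coneFlat X) = finrank K X + 1 := by
  let E : coneFlat X ≃ₗ[K] X × K := LinearEquiv.ofBijective
    (((LinearMap.funLeft K K some).restrict fun _ h => h).prod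
      ((coneFlat X).subtype.coordForm none)) (by
    constructor
    · intro z z' h
      have h1 := congrArg (fun p => p.1.1) h
      have h2 := congrArg Prod.snd h
      refine Subtype.ext (funext fun o => ?_)
      rcases o with _ | v
      · exact h2
      · exact congrFun h1 v
    · rintro ⟨x, c⟩
      exact ⟨⟨fun o => o.elim c x.1, x.2⟩, rfl⟩)
  rw [E.finrank_eq, Module.finrank_prod, Module.finrank_self]

theorem IsFlatFree.coneFlat {s : Multiset ℕ} (h : IsFlatFree K G X s) :
    IsFlatFree K G.addDominating (coneFlat X) (0 ::ₘ s.map (· + 1)) := by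
  classical
  refine IsSplineFree.addDominating (fun hmem => ?_)
    (h.pullback some (fun _ hz => hz) fun x hx => ⟨fun o => o.elim 0 x, hx, fun _ => rfl⟩)
  -- The unit vector at the new vertex lies in the cone; it is killed by all the other coordinate
  -- forms but not by the new one.
  let z : _root_.coneFlat X := ⟨fun o => o.elim 1 0, zero_mem X⟩
  have h1 : ∀ φ ∈ Submodule.span K
      (Set.range fun v => (_root_.coneFlat X).subtype.coordForm (some v)), φ z = 0 := by
    intro φ hφ
    induction hφ using Submodule.span_induction with
    | mem x hx =>
      obtain ⟨v, rfl⟩ := hx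
      rfl
    | zero => rfl
    | add x y _ _ hx hy => rw [LinearMap.add_apply, hx, hy, add_zero]
    | smul c x _ hx => rw [LinearMap.smul_apply, hx, smul_zero]
  exact one_ne_zero (α := K) (h1 _ hmem)

/-- The flats of `G + v` below the cone over the center of `G`. -/
theorem isFlatFree_of_le_coneFlat_center {Y : Submodule K (Option V → K)}
    (hY : Y ∈ (graphicArrangement K G.addDominating).intersectionLattice)
    (hle : Y ≤ coneFlat (graphicArrangement K G).center) :
    IsFlatFree K G.addDominating Y (0 ::ₘ Multiset.replicate (finrank K Y - 1) 1) := by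
  rw [← card_range_coordForm hY]
  refine isSplineFree_addDominating_of_forall_adj_eq (fun v w hvw => LinearMap.ext fun y => ?_)
    fun f hf o o' h => apply_eq_of_mem_splineModule hY hf h
  exact mem_center_graphicArrangement_iff.1 (hle y.2) v w hvw

theorem finrank_pos_of_mem_intersectionLattice [Nonempty V]
    (hX : X ∈ (graphicArrangement K G).intersectionLattice) : 0 < finrank K X := by
  rw [Module.finrank_pos_iff_exists_ne_zero]
  refine ⟨⟨fun _ => 1, const_mem_of_mem_intersectionLattice hX 1⟩, fun h => ?_⟩
  exact one_ne_zero (congrFun (congrArg Subtype.val h) (Classical.arbitrary V))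

/-- In dimension at least two some coordinate form differs from that of the dominating vertex. The
hyperplane of the edge between these vertices cuts `Y` in codimension one. -/
theorem exists_flat_addDominating_lt {Y : Submodule K (Option V → K)}
    (hY : Y ∈ (graphicArrangement K G.addDominating).intersectionLattice) {n : ℕ}
    (hn : finrank K Y = n + 2) :
    ∃ Y' ∈ (graphicArrangement K G.addDominating).intersectionLattice, Y' ≤ Y ∧
      finrank K Y' = n + 1 := by
  obtain ⟨v, hv⟩ : ∃ v, Y.subtype.coordForm (some v) ≠ Y.subtype.coordForm none := by
    by_contra! h
    have h1 := card_range_coordForm hY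
    have h2 : Set.range Y.subtype.coordForm = {Y.subtype.coordForm none} := by
      refine Set.Subset.antisymm ?_ (by rintro _ rfl; exact ⟨none, rfl⟩)
      rintro _ ⟨_ | v, rfl⟩
      · rfl
      · exact h v
    rw [h2, hn] at h1
    simp at h1
  obtain ⟨B, hB, hYB⟩ := hY
  refine ⟨Y ⊓ edgeHyperplane K (some v) none,
    ⟨insert (edgeHyperplane K (some v) none) B, Set.insert_subset ⟨some v, none, trivial, rfl⟩ hB, ?_⟩,
    inf_le_left, ?_⟩
  · rw [sInf_insert, hYB, inf_comm]
  · let φ : Dual K Y := Y.subtype.coordForm (some v) - Y.subtype.coordForm none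
    have hφ : φ ≠ 0 := sub_ne_zero.2 hv
    have h1 := Module.Dual.finrank_ker_add_one_of_ne_zero hφ
    have h2 : (LinearMap.ker φ).map Y.subtype = Y ⊓ edgeHyperplane K (some v) none := by
      ext z
      simp [φ, mem_edgeHyperplane, sub_eq_zero, and_comm]
    rw [← h2, Submodule.finrank_map_subtype_eq]
    omega

theorem finrank_center_addDominating_le :
    finrank K (graphicArrangement K G.addDominating).center ≤ 1 := by
  let φ := (graphicArrangement K G.addDominating).center.subtype.coordForm none
  have hφ : Function.Injective φ := by
    intro x y h
    have hx (o : Option V) (z : (graphicArrangement K G.addDominating).center) :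
        z.1 o = z.1 none := by
      rcases o with _ | v
      · rfl
      · exact mem_center_graphicArrangement_iff.1 z.2 (some v) none trivial
    refine Subtype.ext (funext fun o => ?_)
    rw [hx, hx o y]
    exact h
  simpa using LinearMap.finrank_le_finrank_of_injective hφ

/-- A chain of flats of all dimensions below a flat of `G + v`. -/
theorem exists_chain_addDominating (n : ℕ) {Y : Submodule K (Option V → K)}
    (hY : Y ∈ (graphicArrangement K G.addDominating).intersectionLattice)
    (hn : finrank K Y = n + 1) :
    ∃ S : ℕ → Submodule K (Option V → K), S (n + 1) = Y ∧
      (∀ d, 1 ≤ d → d ≤ n + 1 →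
        S d ∈ (graphicArrangement K G.addDominating).intersectionLattice ∧ finrank K (S d) = d) ∧
      ∀ i j, 1 ≤ i → i ≤ j → j ≤ n + 1 → S i ≤ S j := by
  induction n generalizing Y with
  | zero =>
    refine ⟨fun _ => Y, rfl, fun d h1 h2 => ⟨hY, ?_⟩, fun _ _ _ _ _ => le_rfl⟩
    change finrank K Y = d
    omega
  | succ n ih =>
    obtain ⟨Y', hY', hle, hn'⟩ := exists_flat_addDominating_lt hY hn
    obtain ⟨S, hS, hflat, hmono⟩ := ih hY' hn'
    refine ⟨Function.update S (n + 2) Y, by simp, fun d h1 h2 => ?_, fun i j h1 h2 h3 => ?_⟩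
    · rcases h2.lt_or_eq with h | rfl
      · rw [Function.update_of_ne h.ne]
        exact hflat d h1 (by omega)
      · rw [Function.update_self]
        exact ⟨hY, hn⟩
    · rcases h3.lt_or_eq with h | rfl
      · rw [Function.update_of_ne h.ne, Function.update_of_ne (by omega)]
        exact hmono i j h1 h2 (by omega)
      · rw [Function.update_self]
        rcases h2.lt_or_eq with h | rfl
        · rw [Function.update_of_ne h.ne]
          exact (hmono i (n + 1) h1 (by omega) le_rfl).trans (hS ▸ hle)
        · simp

end Dominating

/-! ### Witnesses for `G + v` -/

section Accuracy

variable {K : Type*} [Field K] {V : Type*} [Finite V] {G : SimpleGraph V}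

theorem finrank_fun_eq_card : finrank K (V → K) = Nat.card V := by
  have := Fintype.ofFinite V
  rw [Module.finrank_fintype_fun_eq_card, Nat.card_eq_fintype_card]

theorem finrank_center_le : finrank K (graphicArrangement K G).center ≤ Nat.card V :=
  (Submodule.finrank_le _).trans_eq finrank_fun_eq_card

theorem eq_center_of_finrank_eq {X : Submodule K (V → K)}
    (hX : X ∈ (graphicArrangement K G).intersectionLattice)
    (h : finrank K X = finrank K (graphicArrangement K G).center) :
    X = (graphicArrangement K G).center :=
  (Submodule.eq_of_le_of_finrank_eq (center_le_of_mem_intersectionLattice hX) h.symm).symm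

theorem length_eq_of_isFreeWithExponents {e : List ℕ}
    (h : (graphicArrangement K G).IsFreeWithExponents e) : e.length = Nat.card V :=
  ((isFreeWithExponents_graphicArrangement_iff e).1 h).card_eq

/-- The first exponents of an accurate graphic arrangement vanish, in the number of the dimension
of the center. -/
theorem take_finrank_center_eq {X : ℕ → Submodule K (V → K)} {e : List ℕ}
    (he : (graphicArrangement K G).IsFreeWithExponents e)
    (hX : ∀ d, 1 ≤ d → finrank K (graphicArrangement K G).center ≤ d → d ≤ finrank K (V → K) →
      X d ∈ (graphicArrangement K G).intersectionLattice ∧ finrank K (X d) = d ∧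
        ((graphicArrangement K G).restriction (X d)).IsFreeWithExponents (e.take d)) :
    e.take (finrank K (graphicArrangement K G).center) =
      List.replicate (finrank K (graphicArrangement K G).center) 0 := by
  set c := finrank K (graphicArrangement K G).center with hc
  rcases Nat.eq_zero_or_pos c with h0 | hpos
  · rw [h0, List.take_zero, List.replicate_zero]
  · have hle : c ≤ Nat.card V := finrank_center_le
    -- The member of dimension `c` can only be the center, where all edge labels vanish.
    obtain ⟨hflat, hrank, hfree⟩ := hX c hpos le_rfl (hle.trans_eq finrank_fun_eq_card.symm)
    rw [isFreeWithExponents_restriction_iff hflat, eq_center_of_finrank_eq hflat hrank] at hfree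
    have h1 := hfree.eq_replicate_zero (by
      rw [Multiset.coe_card, List.length_take, length_eq_of_isFreeWithExponents he,
        min_eq_left hle])
    rw [← Multiset.coe_replicate, Multiset.coe_eq_coe, List.perm_replicate] at h1
    exact h1

/-- A witness for the accuracy of the arrangement of `G` induces one for `G + v`, with the same
flag properties. -/
theorem exists_isAccuracyWitness_addDominating {X : ℕ → Submodule K (V → K)}
    (h : (graphicArrangement K G).IsAccuracyWitness X) :
    ∃ X' : ℕ → Submodule K (Option V → K),
      (graphicArrangement K G.addDominating).IsAccuracyWitness X' ∧
      ∀ m ≤ Nat.card V, (graphicArrangement K G.addDominating).IsFlagUpTo X' (m + 1) ↔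
        (graphicArrangement K G).IsFlagUpTo X m := by
  obtain ⟨e, hsort, hfree, hX⟩ := h
  have htake := take_finrank_center_eq hfree hX
  rw [finrank_fun_eq_card] at hX
  set C := (graphicArrangement K G).center with hC
  set c := finrank K C with hc
  have hcle : c ≤ Nat.card V := finrank_center_le
  have hlen : e.length = Nat.card V := length_eq_of_isFreeWithExponents hfree
  have hcone : coneFlat C ∈ (graphicArrangement K G.addDominating).intersectionLattice :=
    coneFlat_mem_intersectionLattice center_mem_intersectionLattice
  obtain ⟨S, hS, hSflat, hSmono⟩ := exists_chain_addDominating c hcone finrank_coneFlat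
  -- Below dimension `c + 1` a chain inside the cone over the center, above it the cones over the
  -- given witness; the chain ends in the cone over the center.
  let X' : ℕ → Submodule K (Option V → K) := fun d =>
    if d ≤ c + 1 then S d else coneFlat (X (d - 1))
  have hX'S {d : ℕ} (hd : d ≤ c + 1) : X' d = S d := if_pos hd
  have hX'X {d : ℕ} (hd : c < d) : X' (d + 1) = coneFlat (X d) := if_neg (by omega)
  have hX'c : X' (c + 1) = coneFlat C := (hX'S le_rfl).trans hS
  refine ⟨X', ⟨0 :: e.map (· + 1), ?_, ?_, fun d h1 _ h3 => ?_⟩,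
    fun m hm => ⟨fun h => ?_, fun h => ?_⟩⟩
  · refine List.pairwise_cons.2 ⟨fun _ _ => Nat.zero_le _, ?_⟩
    exact List.pairwise_map.2 (hsort.imp fun h => Nat.succ_le_succ h)
  · rw [isFreeWithExponents_graphicArrangement_iff] at hfree ⊢
    have := hfree.coneFlat
    rwa [← Multiset.cons_coe, ← Multiset.map_coe]
  · rw [finrank_fun_eq_card, Finite.card_option] at h3
    rcases le_or_gt d (c + 1) with hd | hd
    · rw [hX'S hd]
      obtain ⟨hflat, hrank⟩ := hSflat d h1 hd
      refine ⟨hflat, hrank, ?_⟩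
      rw [isFreeWithExponents_restriction_iff hflat]
      have h4 := isFlatFree_of_le_coneFlat_center hflat
        (hS ▸ hSmono d (c + 1) h1 hd le_rfl)
      -- Here `d - 1 ≤ c`, so only vanishing exponents of `G` enter, each raised to `1`.
      have h5 : (0 :: e.map (· + 1)).take d = 0 :: List.replicate (d - 1) 1 := by
        obtain ⟨k, rfl⟩ := Nat.exists_eq_add_of_le' h1
        have h6 : e.take k = List.replicate k 0 := by
          rw [← min_eq_left (show k ≤ c by omega), ← List.take_take, htake, List.take_replicate]
        rw [List.take_succ_cons, ← List.map_take, h6, List.map_replicate, Nat.add_sub_cancel]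
      rw [h5, ← Multiset.cons_coe, Multiset.coe_replicate]
      rwa [hrank] at h4
    · obtain ⟨k, rfl⟩ : ∃ k, d = k + 1 := ⟨d - 1, by omega⟩
      rw [hX'X (by omega)]
      obtain ⟨hflat, hrank, hfr⟩ := hX k (by omega) (by omega) (by omega)
      refine ⟨coneFlat_mem_intersectionLattice hflat, by rw [finrank_coneFlat, hrank], ?_⟩
      rw [isFreeWithExponents_restriction_iff (coneFlat_mem_intersectionLattice hflat)]
      rw [isFreeWithExponents_restriction_iff hflat] at hfr
      have := hfr.coneFlat
      rwa [List.take_succ_cons, ← List.map_take, ← Multiset.cons_coe, ← Multiset.map_coe]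
  · intro i j h1 h2 h3 h4
    -- Also for `k = c` the member is a cone, since `X c` is the center; the alternatives on the
    -- right lie outside the range of the flag.
    have hrange (k : ℕ) (hk : c ≤ k) : X' (k + 1) = coneFlat (X k) ∨ k = 0 ∨ m < k := by
      by_cases h0 : k = 0 ∨ m < k
      · exact Or.inr h0
      refine Or.inl ?_
      rcases hk.lt_or_eq with hk' | rfl
      · exact hX'X hk'
      · rw [hX'c]
        obtain ⟨hflat, hrank, -⟩ := hX c (by omega) le_rfl hcle
        rw [eq_center_of_finrank_eq hflat hrank]
    rw [← coneFlat_le_coneFlat_iff, ← (hrange i h2).resolve_right (by omega),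
      ← (hrange j (h2.trans h3)).resolve_right (by omega)]
    exact h (i + 1) (j + 1) (by omega)
      (finrank_center_addDominating_le.trans (by omega)) (by omega) (by omega)
  · intro i j h1 _ h3 h4
    rcases le_or_gt j (c + 1) with hj | hj
    · rw [hX'S hj, hX'S (h3.trans hj)]
      exact hSmono i j h1 h3 hj
    · obtain ⟨l, rfl⟩ : ∃ l, j = l + 1 := ⟨j - 1, by omega⟩
      rcases le_or_gt i (c + 1) with hi | hi
      · rw [hX'S hi, hX'X (by omega)]
        refine (hSmono i (c + 1) h1 hi le_rfl).trans ?_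
        rw [hS, coneFlat_le_coneFlat_iff]
        exact center_le_of_mem_intersectionLattice (hX l (by omega) (by omega) (by omega)).1
      · obtain ⟨k, rfl⟩ : ∃ k, i = k + 1 := ⟨i - 1, by omega⟩
        rw [hX'X (by omega), hX'X (by omega), coneFlat_le_coneFlat_iff]
        exact h k l (by omega) (show c ≤ k by omega) (by omega) (by omega)

theorem isAccurate_addDominating (h : (graphicArrangement K G).IsAccurate) :
    (graphicArrangement K G.addDominating).IsAccurate := by
  obtain ⟨X, hX⟩ := h
  obtain ⟨X', hX', -⟩ := exists_isAccuracyWitness_addDominating hX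
  exact ⟨X', hX'⟩

theorem isCoaccurate_addDominating {k : ℕ}
    (h : (graphicArrangement K G).IsCoaccurate k) :
    (graphicArrangement K G.addDominating).IsCoaccurate k := by
  obtain ⟨X, hX, hflag⟩ := h
  obtain ⟨X', hX', hiff⟩ := exists_isAccuracyWitness_addDominating hX
  refine ⟨X', hX', ?_⟩
  rw [finrank_fun_eq_card] at hflag ⊢
  rw [Finite.card_option]
  rcases le_or_gt k (Nat.card V) with hle | hlt
  · rw [Nat.sub_add_comm hle]
    exact (hiff _ (Nat.sub_le _ _)).2 hflag
  -- For `k > |V|` the truncated difference `|V| + 1 - k` is `0`, and the flag condition is empty.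
  · intro i j h1 _ h3 h4
    omega

/-- Minimality of `k` needs the converse direction as well: a longer flag in the new witness would
give one in the old. -/
theorem isStrictlyCoaccurate_addDominating {k : ℕ}
    (h : (graphicArrangement K G).IsStrictlyCoaccurate k) :
    (graphicArrangement K G.addDominating).IsStrictlyCoaccurate k := by
  obtain ⟨X, hX, ⟨hk1, hk2, hflag⟩, hleast⟩ := h
  obtain ⟨X', hX', hiff⟩ := exists_isAccuracyWitness_addDominating hX
  refine ⟨X', hX', ?_⟩
  simp only [finrank_fun_eq_card, Finite.card_option] at hk2 hflag hleast ⊢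
  refine ⟨⟨hk1, by omega, ?_⟩, fun j hj => ?_⟩
  · rw [Nat.sub_add_comm hk2.le]
    exact (hiff _ (Nat.sub_le _ _)).2 hflag
  · obtain ⟨hj1, hj2, hj3⟩ := hj
    rcases (Nat.lt_succ_iff.1 hj2).lt_or_eq with hlt | rfl
    · rw [Nat.sub_add_comm hlt.le] at hj3
      exact hleast ⟨hj1, hlt, (hiff _ (Nat.sub_le _ _)).1 hj3⟩
    -- The value `j = |V|` is admitted for `G + v` but not for `G`; it exceeds `k` anyway.
    · exact hk2.le

end Accuracy

/-! ### Flag-accuracy in terms of chains, and merging of chains -/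

section Chains

/-- A chain of flats of the graphic arrangement of `G` from the center to `X`, of all dimensions in
between, such that each restriction is free and its exponents are an initial segment of those of
the restriction to `X`. The exponents are listed in descending order. -/
inductive IsFreeChain (K : Type*) [Field K] {V : Type*} [Finite V] (G : SimpleGraph V) :
    Submodule K (V → K) → List ℕ → Prop
  | base (n : ℕ) (hn : n = finrank K (graphicArrangement K G).center)
      (hfree : IsFlatFree K G (graphicArrangement K G).center (Multiset.replicate n 0)) :
      IsFreeChain K G (graphicArrangement K G).center (List.replicate n 0)
  | step (X X' : Submodule K (V → K)) (a : ℕ) (e : List ℕ) (hX' : IsFreeChain K G X' e)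
      (hle : X' ≤ X) (hX : X ∈ (graphicArrangement K G).intersectionLattice)
      (hrank : finrank K X = finrank K X' + 1) (ha : ∀ m ∈ e, m ≤ a)
      (hfree : IsFlatFree K G X (a :: e : List ℕ)) : IsFreeChain K G X (a :: e)

variable {K : Type*} [Field K] {V W U : Type*} [Finite V] [Finite W] [Finite U]
  {G : SimpleGraph V} {H : SimpleGraph W} {Γ : SimpleGraph U}

namespace IsFreeChain

theorem mem_intersectionLattice {X : Submodule K (V → K)} {e : List ℕ} (h : IsFreeChain K G X e) :
    X ∈ (graphicArrangement K G).intersectionLattice := by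
  cases h with
  | base => exact center_mem_intersectionLattice
  | step _ _ _ _ _ _ hX => exact hX

theorem isFlatFree {X : Submodule K (V → K)} {e : List ℕ} (h : IsFreeChain K G X e) :
    IsFlatFree K G X e := by
  cases h with
  | base n _ hfree => rwa [Multiset.coe_replicate]
  | step _ _ _ _ _ _ _ _ _ hfree => exact hfree

theorem length_eq {X : Submodule K (V → K)} {e : List ℕ} (h : IsFreeChain K G X e) :
    e.length = finrank K X := by
  induction h with
  | base n hn _ => rw [List.length_replicate, hn]
  | step X X' a e _ _ _ hrank _ _ ih => rw [List.length_cons, hrank, ih]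

theorem pairwise {X : Submodule K (V → K)} {e : List ℕ} (h : IsFreeChain K G X e) :
    e.reverse.Pairwise (· ≤ ·) := by
  rw [List.pairwise_reverse]
  induction h with
  | base n _ _ => exact List.pairwise_replicate.2 (Or.inr le_rfl)
  | step X X' a e _ _ _ _ ha _ ih => exact List.pairwise_cons.2 ⟨ha, ih⟩

/-- Reversed, the exponents of a step extend those of the smaller flat at the end, so the initial
segments found earlier stay valid. -/
theorem exists_flag {X : Submodule K (V → K)} {e : List ℕ} (h : IsFreeChain K G X e) :
    ∃ S : ℕ → Submodule K (V → K),
      (∀ d, finrank K (graphicArrangement K G).center ≤ d → d ≤ finrank K X →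
        S d ≤ X ∧ S d ∈ (graphicArrangement K G).intersectionLattice ∧ finrank K (S d) = d ∧
          IsFlatFree K G (S d) (e.reverse.take d : List ℕ)) ∧
      ∀ i j, finrank K (graphicArrangement K G).center ≤ i → i ≤ j → j ≤ finrank K X →
        S i ≤ S j := by
  induction h with
  | base n hn hfree =>
    refine ⟨fun _ => (graphicArrangement K G).center, fun d h1 h2 => ?_, fun _ _ _ _ _ => le_rfl⟩
    obtain rfl : d = n := by omega
    refine ⟨le_rfl, center_mem_intersectionLattice, hn.symm, ?_⟩
    rwa [List.reverse_replicate, List.take_replicate, min_self, Multiset.coe_replicate]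
  | step X X' a e hX' hle hX hrank ha hfree ih =>
    obtain ⟨S, hS, hmono⟩ := ih
    have hlen := hX'.length_eq
    have hc := Submodule.finrank_mono
      (center_le_of_mem_intersectionLattice hX'.mem_intersectionLattice)
    refine ⟨Function.update S (finrank K X) X, fun d h1 h2 => ?_, fun i j h1 h2 h3 => ?_⟩
    · rcases h2.lt_or_eq with h | rfl
      · rw [Function.update_of_ne h.ne]
        obtain ⟨h4, h5, h6, h7⟩ := hS d h1 (by omega)
        refine ⟨h4.trans hle, h5, h6, ?_⟩
        rw [List.reverse_cons, List.take_append_of_le_length (by rw [List.length_reverse]; omega)]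
        exact h7
      · rw [Function.update_self]
        refine ⟨le_rfl, hX, rfl, ?_⟩
        rw [List.take_of_length_le (by rw [List.length_reverse, List.length_cons]; omega),
          Multiset.coe_reverse]
        exact hfree
    · rcases h3.lt_or_eq with h | rfl
      · rw [Function.update_of_ne h.ne, Function.update_of_ne (by omega)]
        exact hmono i j h1 h2 (by omega)
      · rw [Function.update_self]
        rcases h2.lt_or_eq with h | rfl
        · rw [Function.update_of_ne h.ne]
          exact (hS i h1 (by omega)).1.trans hle
        · simp

theorem isFlagAccurate {e : List ℕ} (h : IsFreeChain K G ⊤ e) :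
    (graphicArrangement K G).IsFlagAccurate := by
  obtain ⟨S, hS, hmono⟩ := h.exists_flag
  rw [finrank_top] at hS hmono
  refine ⟨S, ⟨e.reverse, h.pairwise, ?_, fun d _ h2 h3 => ?_⟩, fun i j _ h2 h3 h4 => ?_⟩
  · rw [isFreeWithExponents_graphicArrangement_iff, Multiset.coe_reverse]
    exact h.isFlatFree
  · obtain ⟨-, h4, h5, h6⟩ := hS d h2 h3
    exact ⟨h4, h5, (isFreeWithExponents_restriction_iff h4 _).2 h6⟩
  · exact hmono i j h2 h3 (h4.trans (Nat.sub_le _ _))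

end IsFreeChain

/-- Converse of `IsFreeChain.isFlagAccurate`. A nonempty vertex set makes the center
positive-dimensional, so the range of the witness starts at the center, as a chain does. -/
theorem exists_isFreeChain_of_isFlagAccurate [Nonempty V]
    (h : (graphicArrangement K G).IsFlagAccurate) : ∃ e, IsFreeChain K G ⊤ e := by
  obtain ⟨X, ⟨e, hsort, hfree, hX⟩, hflag⟩ := h
  have htake := take_finrank_center_eq hfree hX
  have hpos : 0 < finrank K (graphicArrangement K G).center :=
    finrank_pos_of_mem_intersectionLattice center_mem_intersectionLattice
  have hlen := length_eq_of_isFreeWithExponents hfree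
  have hcle : finrank K (graphicArrangement K G).center ≤ Nat.card V := finrank_center_le
  rw [finrank_fun_eq_card] at hX
  rw [CentralArrangement.IsFlagUpTo, finrank_fun_eq_card] at hflag
  set c := finrank K (graphicArrangement K G).center with hc
  have key (n : ℕ) (hn : c + n ≤ Nat.card V) :
      IsFreeChain K G (X (c + n)) (e.take (c + n)).reverse := by
    induction n with
    | zero =>
      obtain ⟨hflat, hrank, hfr⟩ := hX c hpos le_rfl hcle
      rw [isFreeWithExponents_restriction_iff hflat, eq_center_of_finrank_eq hflat hrank,
        htake, Multiset.coe_replicate] at hfr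
      rw [add_zero, eq_center_of_finrank_eq hflat hrank, htake, List.reverse_replicate]
      exact IsFreeChain.base c hc hfr
    | succ n ih =>
      obtain ⟨hflat, hrank, hfr⟩ := hX (c + n) (by omega) (by omega) (by omega)
      obtain ⟨hflat', hrank', hfr'⟩ := hX (c + (n + 1)) (by omega) (by omega) hn
      have hlt : c + n < e.length := by omega
      have hsucc : (e.take (c + (n + 1))).reverse = e[c + n] :: (e.take (c + n)).reverse := by
        rw [← add_assoc, List.take_succ_eq_append_getElem hlt, List.reverse_append]
        rfl
      rw [isFreeWithExponents_restriction_iff hflat', ← Multiset.coe_reverse, hsucc] at hfr'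
      rw [hsucc]
      refine IsFreeChain.step _ _ _ _ (ih (by omega)) ?_ hflat' (by omega) (fun m hm => ?_) hfr'
      · rcases hn.lt_or_eq with h | h
        · exact hflag _ _ (by omega) (by omega) (by omega) (by omega)
        -- The flag condition ends at dimension `ℓ - 1`, but the last member is the whole space.
        · have htop : X (c + (n + 1)) = ⊤ :=
            Submodule.eq_top_of_finrank_eq (by rw [hrank', h, finrank_fun_eq_card])
          rw [htop]
          exact le_top
      · rw [List.mem_reverse, List.mem_take_iff_getElem] at hm
        obtain ⟨k, hk, rfl⟩ := hm
        exact List.pairwise_iff_getElem.1 hsort k (c + n) _ _ (by omega)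
  have htop : X (Nat.card V) = ⊤ :=
    Submodule.eq_top_of_finrank_eq (by
      rw [(hX (Nat.card V) (by omega) hcle le_rfl).2.1, finrank_fun_eq_card])
  have h1 := key (Nat.card V - c) (by omega)
  rw [Nat.add_sub_cancel' hcle, htop] at h1
  exact ⟨_, h1⟩

/-- Chains for `G` and for `H` merge into a chain for `Γ`, if pairs of flats of `G` and `H` give
flats of `Γ`. -/
theorem IsFreeChain.exists_merge (δ : ℕ)
    (op : Submodule K (V → K) → Submodule K (W → K) → Submodule K (U → K))
    (hmono : ∀ X X' Y Y', X ≤ X' → Y ≤ Y' → op X Y ≤ op X' Y')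
    (hflat : ∀ X ∈ (graphicArrangement K G).intersectionLattice,
      ∀ Y ∈ (graphicArrangement K H).intersectionLattice,
      op X Y ∈ (graphicArrangement K Γ).intersectionLattice)
    (hcenter : op (graphicArrangement K G).center (graphicArrangement K H).center =
      (graphicArrangement K Γ).center)
    (hrank : ∀ X ∈ (graphicArrangement K G).intersectionLattice,
      ∀ Y ∈ (graphicArrangement K H).intersectionLattice,
      finrank K (op X Y) + δ = finrank K X + finrank K Y)
    (hfree : ∀ X ∈ (graphicArrangement K G).intersectionLattice,
      ∀ Y ∈ (graphicArrangement K H).intersectionLattice, ∀ r s t : Multiset ℕ,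
      IsFlatFree K G X s → IsFlatFree K H Y t → r + Multiset.replicate δ 0 = s + t →
      IsFlatFree K Γ (op X Y) r) (n : ℕ) :
    ∀ (X : Submodule K (V → K)) (Y : Submodule K (W → K)) (e f : List ℕ),
      IsFreeChain K G X e → IsFreeChain K H Y f → e.length + f.length = n →
      ∃ l : List ℕ, (l : Multiset ℕ) + Multiset.replicate δ 0 = (e : Multiset ℕ) + (f : Multiset ℕ) ∧
        IsFreeChain K Γ (op X Y) l := by
  -- Merging of descending lists: the larger of the two leading exponents bounds all others, so
  -- undoing its step in `X` or in `Y` leaves a shorter problem. The number `δ` counts the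
  -- dimensions, and exponents `0`, that gluing loses.
  induction n using Nat.strong_induction_on with
  | _ n ih =>
  intro X Y e f he hf hn
  have hbound {l e f : List ℕ} {a : ℕ}
      (hl : (l : Multiset ℕ) + Multiset.replicate δ 0 = (e : Multiset ℕ) + (f : Multiset ℕ))
      (he : ∀ m ∈ e, m ≤ a) (hf : ∀ m ∈ f, m ≤ a) : ∀ m ∈ l, m ≤ a := by
    intro m hm
    have : m ∈ (e : Multiset ℕ) + (f : Multiset ℕ) := by
      rw [← hl]
      exact Multiset.mem_add.2 (Or.inl hm)
    rcases Multiset.mem_add.1 this with h | h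
    · exact he m h
    · exact hf m h
  have left (X X' : Submodule K (V → K)) (a : ℕ) (e : List ℕ) (hX' : IsFreeChain K G X' e)
      (hX : IsFreeChain K G X (a :: e)) (hle : X' ≤ X) (hr : finrank K X = finrank K X' + 1)
      (ha : ∀ m ∈ e, m ≤ a) (hfa : ∀ m ∈ f, m ≤ a) (hn : (a :: e).length + f.length = n) :
      ∃ l : List ℕ, (l : Multiset ℕ) + Multiset.replicate δ 0 = ((a :: e : List ℕ) : Multiset ℕ) + (f : Multiset ℕ) ∧
        IsFreeChain K Γ (op X Y) l := by
    obtain ⟨l, hl, hchain⟩ := ih (e.length + f.length) (by rw [← hn, List.length_cons]; omega)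
      X' Y e f hX' hf rfl
    have hsum : ((a :: l : List ℕ) : Multiset ℕ) + Multiset.replicate δ 0 =
        ((a :: e : List ℕ) : Multiset ℕ) + (f : Multiset ℕ) := by
      rw [← Multiset.cons_coe, ← Multiset.cons_coe, Multiset.cons_add, hl, Multiset.cons_add]
    have h1 := hrank X hX.mem_intersectionLattice Y hf.mem_intersectionLattice
    have h2 := hrank X' hX'.mem_intersectionLattice Y hf.mem_intersectionLattice
    exact ⟨a :: l, hsum, IsFreeChain.step _ _ a l hchain (hmono _ _ _ _ hle le_rfl)
      (hflat _ hX.mem_intersectionLattice _ hf.mem_intersectionLattice) (by omega)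
      (hbound hl ha hfa) (hfree _ hX.mem_intersectionLattice _ hf.mem_intersectionLattice _ _ _
        hX.isFlatFree hf.isFlatFree hsum)⟩
  have right (Y Y' : Submodule K (W → K)) (a : ℕ) (f : List ℕ) (hY' : IsFreeChain K H Y' f)
      (hY : IsFreeChain K H Y (a :: f)) (hle : Y' ≤ Y) (hr : finrank K Y = finrank K Y' + 1)
      (ha : ∀ m ∈ f, m ≤ a) (hea : ∀ m ∈ e, m ≤ a) (hn : e.length + (a :: f).length = n) :
      ∃ l : List ℕ, (l : Multiset ℕ) + Multiset.replicate δ 0 = (e : Multiset ℕ) + ((a :: f : List ℕ) : Multiset ℕ) ∧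
        IsFreeChain K Γ (op X Y) l := by
    obtain ⟨l, hl, hchain⟩ := ih (e.length + f.length) (by rw [← hn, List.length_cons]; omega)
      X Y' e f he hY' rfl
    have hsum : ((a :: l : List ℕ) : Multiset ℕ) + Multiset.replicate δ 0 =
        (e : Multiset ℕ) + ((a :: f : List ℕ) : Multiset ℕ) := by
      rw [← Multiset.cons_coe, ← Multiset.cons_coe, Multiset.cons_add, hl, Multiset.add_cons]
    have h1 := hrank X he.mem_intersectionLattice Y hY.mem_intersectionLattice
    have h2 := hrank X he.mem_intersectionLattice Y' hY'.mem_intersectionLattice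
    exact ⟨a :: l, hsum, IsFreeChain.step _ _ a l hchain (hmono _ _ _ _ le_rfl hle)
      (hflat _ he.mem_intersectionLattice _ hY.mem_intersectionLattice) (by omega)
      (hbound hl hea ha) (hfree _ he.mem_intersectionLattice _ hY.mem_intersectionLattice _ _ _
        he.isFlatFree hY.isFlatFree hsum)⟩
  have hzero {k a : ℕ} : ∀ m ∈ List.replicate k 0, m ≤ a := fun m hm => by
    rw [List.eq_of_mem_replicate hm]
    exact Nat.zero_le _
  have hcons {e : List ℕ} {a b : ℕ} (h : ∀ m ∈ e, m ≤ a) (hab : a ≤ b) :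
      ∀ m ∈ a :: e, m ≤ b := by
    intro m hm
    rcases List.mem_cons.1 hm with rfl | hm
    · exact hab
    · exact (h m hm).trans hab
  have he' := he
  have hf' := hf
  cases he with
  | base k hk hbase =>
    cases hf with
    | base k' hk' hbase' =>
      have h1 := hrank _ center_mem_intersectionLattice _ center_mem_intersectionLattice
      rw [hcenter, ← hk, ← hk'] at h1
      have h2 : Multiset.replicate (finrank K (graphicArrangement K Γ).center) 0 +
          Multiset.replicate δ 0 = Multiset.replicate k 0 + Multiset.replicate k' 0 := by
        rw [← Multiset.replicate_add, h1, Multiset.replicate_add]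
      refine ⟨List.replicate _ 0, h2, ?_⟩
      rw [hcenter]
      refine IsFreeChain.base _ rfl ?_
      rw [← hcenter]
      refine hfree _ center_mem_intersectionLattice _ center_mem_intersectionLattice _ _ _
        hbase hbase' ?_
      rw [hcenter, h2]
    | step _ Y' b f hY' hle' hY hr' hb hfr' =>
      exact right Y Y' b f hY' hf' hle' hr' hb hzero hn
  | step _ X' a e hX' hle hX hr ha hfr =>
    cases hf with
    | base k' hk' hbase' => exact left X X' a e hX' he' hle hr ha hzero hn
    | step _ Y' b f hY' hle' hY hr' hb hfr' =>
      -- The larger exponent has to be removed first, so that it bounds the exponents of the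
      -- remaining merged chain.
      rcases le_total a b with hab | hab
      · exact right Y Y' b f hY' hf' hle' hr' hb (hcons ha hab) hn
      · exact left X X' a e hX' he' hle hr ha (hcons hb hab) hn

end Chains

/-! ### Gluing of graphs and the class `InClassG` -/

section Union

variable {K : Type*} [Field K] {V W U : Type*} {G : SimpleGraph V} {H : SimpleGraph W}
  {Γ : SimpleGraph U} {i : V → U} {j : W → U}

/-- The subspace of `K^U` that consists of the vectors the restrictions of which along `i` and `j`
lie in `X` and `Y`. -/
def unionFlat (i : V → U) (j : W → U) (X : Submodule K (V → K)) (Y : Submodule K (W → K)) :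
    Submodule K (U → K) :=
  X.comap (LinearMap.funLeft K K i) ⊓ Y.comap (LinearMap.funLeft K K j)

theorem mem_unionFlat {X : Submodule K (V → K)} {Y : Submodule K (W → K)} {z : U → K} :
    z ∈ unionFlat i j X Y ↔ (fun v => z (i v)) ∈ X ∧ (fun w => z (j w)) ∈ Y := Iff.rfl

/-- The two restrictions of a vector in `unionFlat i j X Y`. -/
def unionFlatToProd (i : V → U) (j : W → U) (X : Submodule K (V → K)) (Y : Submodule K (W → K)) :
    unionFlat i j X Y →ₗ[K] X × Y :=
  ((LinearMap.funLeft K K i).restrict fun z (hz : z ∈ unionFlat i j X Y) => hz.1).prod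
    ((LinearMap.funLeft K K j).restrict fun z (hz : z ∈ unionFlat i j X Y) => hz.2)

namespace IsGraphUnion

theorem unionFlatToProd_injective (h : IsGraphUnion Γ G H i j) {X : Submodule K (V → K)}
    {Y : Submodule K (W → K)} : Function.Injective (unionFlatToProd i j X Y) := fun _ _ hz =>
  Subtype.ext (h.funext (congrFun (congrArg (fun p => p.1.1) hz))
    (congrFun (congrArg (fun p => p.2.1) hz)))

theorem exists_glue (h : IsGraphUnion Γ G H i j) {A : Type*} (x : V → A) (y : W → A)
    (hxy : ∀ v w, i v = j w → x v = y w) : ∃ z : U → A, (∀ v, z (i v) = x v) ∧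
      ∀ w, z (j w) = y w := by
  classical
  have hex (u : U) : ∃ a : A, (∀ v, i v = u → x v = a) ∧ ∀ w, j w = u → y w = a := by
    rcases h.cover u with ⟨v, rfl⟩ | ⟨w, rfl⟩
    · exact ⟨x v, fun v' hv' => congrArg x (h.injective_left hv'),
        fun w hw => (hxy v w hw.symm).symm⟩
    · exact ⟨y w, fun v hv => hxy v w hv, fun w' hw' => congrArg y (h.injective_right hw')⟩
  choose z hz using hex
  exact ⟨z, fun v => ((hz _).1 v rfl).symm, fun w => ((hz _).2 w rfl).symm⟩

variable [Finite V] [Finite W] [Finite U] (h : IsGraphUnion Γ G H i j)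
include h

theorem unionFlat_center : unionFlat i j (graphicArrangement K G).center
    (graphicArrangement K H).center = (graphicArrangement K Γ).center := by
  ext z
  simp only [mem_unionFlat, mem_center_graphicArrangement_iff]
  exact ⟨fun hz => h.forall_adj (p := fun u u' => z u = z u') hz.1 hz.2,
    fun hz => ⟨fun v v' hv => hz _ _ (h.adj_left hv), fun w w' hw => hz _ _ (h.adj_right hw)⟩⟩

theorem unionFlat_mem_intersectionLattice {X : Submodule K (V → K)}
    (hX : X ∈ (graphicArrangement K G).intersectionLattice) {Y : Submodule K (W → K)}
    (hY : Y ∈ (graphicArrangement K H).intersectionLattice) :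
    unionFlat i j X Y ∈ (graphicArrangement K Γ).intersectionLattice := by
  obtain ⟨r, hr, hXr⟩ := mem_intersectionLattice_graphicArrangement_iff.1 hX
  obtain ⟨s, hs, hYs⟩ := mem_intersectionLattice_graphicArrangement_iff.1 hY
  refine mem_intersectionLattice_graphicArrangement_iff.2
    ⟨fun u u' => (∃ v v', r v v' ∧ i v = u ∧ i v' = u') ∨ ∃ w w', s w w' ∧ j w = u ∧ j w' = u',
      ?_, fun z => ?_⟩
  · rintro _ _ (⟨v, v', hv, rfl, rfl⟩ | ⟨w, w', hw, rfl, rfl⟩)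
    · exact h.adj_left (hr _ _ hv)
    · exact h.adj_right (hs _ _ hw)
  · rw [mem_unionFlat, hXr, hYs]
    constructor
    · rintro ⟨h1, h2⟩ _ _ (⟨v, v', hv, rfl, rfl⟩ | ⟨w, w', hw, rfl, rfl⟩)
      · exact h1 _ _ hv
      · exact h2 _ _ hw
    · exact fun h1 => ⟨fun v v' hv => h1 _ _ (Or.inl ⟨v, v', hv, rfl, rfl⟩),
        fun w w' hw => h1 _ _ (Or.inr ⟨w, w', hw, rfl, rfl⟩)⟩

/-- Chains for `G` and `H` give a chain for their disjoint union. -/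
theorem exists_isFreeChain_of_disjoint (hd : ∀ v w, i v ≠ j w)
    (hG : ∃ e, IsFreeChain K G ⊤ e) (hH : ∃ f, IsFreeChain K H ⊤ f) :
    ∃ l, IsFreeChain K Γ ⊤ l := by
  obtain ⟨e, he⟩ := hG
  obtain ⟨f, hf⟩ := hH
  suffices hl : ∃ l : List ℕ, (l : Multiset ℕ) + Multiset.replicate 0 0 = (e : Multiset ℕ) + (f : Multiset ℕ) ∧
      IsFreeChain K Γ (unionFlat i j ⊤ ⊤) l by
    obtain ⟨l, -, hl⟩ := hl
    exact ⟨l, by simpa [unionFlat] using hl⟩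
  refine IsFreeChain.exists_merge (Γ := Γ) 0 (unionFlat i j)
    (fun X X' Y Y' hX hY => inf_le_inf (Submodule.comap_mono hX) (Submodule.comap_mono hY))
    (fun X hX Y hY => h.unionFlat_mem_intersectionLattice hX hY) h.unionFlat_center ?_ ?_ _
    ⊤ ⊤ e f he hf rfl
  · intro X hX Y hY
    let E := LinearEquiv.ofBijective (unionFlatToProd (K := K) i j X Y) (by
      refine ⟨h.unionFlatToProd_injective, ?_⟩
      rintro ⟨⟨x, hx⟩, ⟨y, hy⟩⟩
      obtain ⟨z, hzx, hzy⟩ := h.exists_glue x y fun v w hvw => (hd v w hvw).elim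
      obtain rfl : (fun v => z (i v)) = x := _root_.funext hzx
      obtain rfl : (fun w => z (j w)) = y := _root_.funext hzy
      exact ⟨⟨z, hx, hy⟩, rfl⟩)
    rw [add_zero, E.finrank_eq, Module.finrank_prod]
  · intro X hX Y hY r s t hs ht hr
    rw [Multiset.replicate_zero, add_zero] at hr
    rw [hr]
    refine h.isSplineFree_of_disjoint hd (hs.pullback i (fun _ hz => hz.1) fun x hx => ?_)
      (ht.pullback j (fun _ hz => hz.2) fun y hy => ?_)
    -- A point of `X` extends by zero, since the two graphs share no vertex.
    · obtain ⟨z, hzx, hzy⟩ := h.exists_glue x 0 fun v w hvw => (hd v w hvw).elim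
      obtain rfl : (fun v => z (i v)) = x := _root_.funext hzx
      refine ⟨z, ⟨hx, ?_⟩, fun _ => rfl⟩
      change (fun w => z (j w)) ∈ Y
      rw [show (fun w => z (j w)) = 0 from _root_.funext hzy]
      exact zero_mem Y
    · obtain ⟨z, hzx, hzy⟩ := h.exists_glue 0 y fun v w hvw => (hd v w hvw).elim
      obtain rfl : (fun w => z (j w)) = y := _root_.funext hzy
      refine ⟨z, ⟨?_, hy⟩, fun _ => rfl⟩
      change (fun v => z (i v)) ∈ X
      rw [show (fun v => z (i v)) = 0 from _root_.funext hzx]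
      exact zero_mem X

/-- Chains for `G` and `H` give a chain for their vertex identification. -/
theorem exists_isFreeChain_of_inter_singleton {g : V} {g' : W}
    (hg : ∀ v w, i v = j w ↔ v = g ∧ w = g')
    (hG : ∃ e, IsFreeChain K G ⊤ e) (hH : ∃ f, IsFreeChain K H ⊤ f) :
    ∃ l, IsFreeChain K Γ ⊤ l := by
  obtain ⟨e, he⟩ := hG
  obtain ⟨f, hf⟩ := hH
  have hgg : i g = j g' := (hg g g').2 ⟨rfl, rfl⟩
  suffices hl : ∃ l : List ℕ, (l : Multiset ℕ) + Multiset.replicate 1 0 = (e : Multiset ℕ) + (f : Multiset ℕ) ∧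
      IsFreeChain K Γ (unionFlat i j ⊤ ⊤) l by
    obtain ⟨l, -, hl⟩ := hl
    exact ⟨l, by simpa [unionFlat] using hl⟩
  refine IsFreeChain.exists_merge (Γ := Γ) 1 (unionFlat i j)
    (fun X X' Y Y' hX hY => inf_le_inf (Submodule.comap_mono hX) (Submodule.comap_mono hY))
    (fun X hX Y hY => h.unionFlat_mem_intersectionLattice hX hY) h.unionFlat_center ?_ ?_ _
    ⊤ ⊤ e f he hf rfl
  · intro X hX Y hY
    -- Pairs that glue are those with equal values at the shared vertex: the kernel of a nonzero
    -- functional, whence the loss of one dimension.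
    let φ : Dual K (X × Y) :=
      (X.subtype.coordForm g).coprod (-Y.subtype.coordForm g')
    have hφ : φ ≠ 0 := by
      intro h0
      have h1 := LinearMap.congr_fun h0
        (⟨fun _ => 1, const_mem_of_mem_intersectionLattice hX 1⟩, 0)
      simp [φ] at h1
    have hrange : LinearMap.range (unionFlatToProd i j X Y) = LinearMap.ker φ := by
      ext ⟨⟨x, hx⟩, ⟨y, hy⟩⟩
      have hφ' : φ (⟨x, hx⟩, ⟨y, hy⟩) = x g - y g' := by simp [φ, sub_eq_add_neg]
      rw [LinearMap.mem_ker, hφ', sub_eq_zero]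
      constructor
      · rintro ⟨z, hz⟩
        have h1 : z.1 (i g) = x g := congrFun (congrArg (fun p => p.1.1) hz) g
        have h2 : z.1 (j g') = y g' := congrFun (congrArg (fun p => p.2.1) hz) g'
        rw [← h1, ← h2, hgg]
      · intro hxy
        obtain ⟨z, hzx, hzy⟩ := h.exists_glue x y fun v w hvw => by
          obtain ⟨rfl, rfl⟩ := (hg v w).1 hvw
          exact hxy
        obtain rfl : (fun v => z (i v)) = x := _root_.funext hzx
        obtain rfl : (fun w => z (j w)) = y := _root_.funext hzy
        exact ⟨⟨z, hx, hy⟩, rfl⟩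
    rw [← LinearMap.finrank_range_of_inj h.unionFlatToProd_injective, hrange,
      Module.Dual.finrank_ker_add_one_of_ne_zero hφ, Module.finrank_prod]
  · intro X hX Y hY r s t hs ht hr
    rw [Multiset.replicate_one, add_comm, Multiset.singleton_add] at hr
    refine h.isSplineFree_of_inter_singleton hg (hs.pullback i (fun _ hz => hz.1) fun x hx => ?_)
      (ht.pullback j (fun _ hz => hz.2) fun y hy => ?_) hr
    -- Extend by the constant `x g`: it matches `x` at the shared vertex, and all flats contain the
    -- constant vectors.
    · obtain ⟨z, hzx, hzy⟩ := h.exists_glue x (fun _ => x g) fun v w hvw => by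
        rw [((hg v w).1 hvw).1]
      obtain rfl : (fun v => z (i v)) = x := _root_.funext hzx
      refine ⟨z, ⟨hx, ?_⟩, fun _ => rfl⟩
      change (fun w => z (j w)) ∈ Y
      rw [show (fun w => z (j w)) = _ from _root_.funext hzy]
      exact const_mem_of_mem_intersectionLattice hY _
    · obtain ⟨z, hzx, hzy⟩ := h.exists_glue (fun _ => y g') y fun v w hvw => by
        rw [((hg v w).1 hvw).2]
      obtain rfl : (fun w => z (j w)) = y := _root_.funext hzy
      refine ⟨z, ⟨?_, hy⟩, fun _ => rfl⟩
      change (fun v => z (i v)) ∈ X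
      rw [show (fun v => z (i v)) = _ from _root_.funext hzx]
      exact const_mem_of_mem_intersectionLattice hX _

end IsGraphUnion

namespace SimpleGraph

theorem isGraphUnion_sum (G : SimpleGraph V) (H : SimpleGraph W) :
    IsGraphUnion (G ⊕g H) G H Sum.inl Sum.inr where
  injective_left := Sum.inl_injective
  injective_right := Sum.inr_injective
  cover := by rintro (v | w) <;> simp
  adj_iff := by rintro (v | w) (v' | w') <;> simp

/-- An isomorphic copy of `G` is a disjoint union of `G` with the graph without vertices, so
invariance under isomorphism is a case of disjoint union. -/
theorem isGraphUnion_of_iso {G : SimpleGraph V} {H : SimpleGraph W} (e : G ≃g H) :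
    IsGraphUnion H G (⊥ : SimpleGraph Empty) e Empty.elim where
  injective_left := e.injective
  injective_right := fun x => x.elim
  cover u := Or.inl ⟨e.symm u, e.apply_symm_apply u⟩
  adj_iff u u' := by
    constructor
    · intro h
      exact Or.inl ⟨e.symm u, e.symm u', e.symm.map_adj_iff.2 h, e.apply_symm_apply u,
        e.apply_symm_apply u'⟩
    · rintro (⟨v, v', h, rfl, rfl⟩ | ⟨w, -⟩)
      · exact e.map_adj_iff.2 h
      · exact w.elim

theorem identEmbedding_eq_inl_iff {V W : Type u} (g : V) (h : W) (v : V) (w : W) :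
    Sum.inl v = identEmbedding g h w ↔ v = g ∧ w = h := by
  by_cases hw : w = h
  · rw [show identEmbedding g h w = Sum.inl g from dif_pos hw]
    simp [hw]
  · rw [show identEmbedding g h w = Sum.inr ⟨w, hw⟩ from dif_neg hw]
    simp [hw]

theorem isGraphUnion_vertexIdentification {V W : Type u} (G : SimpleGraph V) (g : V)
    (H : SimpleGraph W) (h : W) :
    IsGraphUnion (G.vertexIdentification g H h) G H Sum.inl (identEmbedding g h) where
  injective_left := Sum.inl_injective
  injective_right := (identEmbedding g h).injective
  cover := by
    rintro (v | ⟨w, hw⟩)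
    · exact Or.inl ⟨v, rfl⟩
    · exact Or.inr ⟨w, dif_neg hw⟩
  adj_iff u u' := by
    simp only [vertexIdentification, sup_adj, map_adj]
    rfl

end SimpleGraph

/-- Without edges the center is the whole space, and the chain has no steps. -/
theorem exists_isFreeChain_of_forall_not_adj [Finite V] (hG : ∀ v w, ¬ G.Adj v w) :
    ∃ e, IsFreeChain K G ⊤ e := by
  have := Fintype.ofFinite V
  have hc : (graphicArrangement K G).center = ⊤ := by
    ext x
    simp [mem_center_graphicArrangement_iff, hG]
  rw [← hc]
  refine ⟨_, IsFreeChain.base (finrank K (graphicArrangement K G).center) rfl ?_⟩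
  have h1 : finrank K (graphicArrangement K G).center = Fintype.card V := by
    rw [hc, finrank_top, Module.finrank_fintype_fun_eq_card]
  rw [h1]
  exact isSplineFree_of_forall_not_adj hG _

namespace SimpleGraph

theorem InClassG.finite_and_nonempty {V : Type*} {G : SimpleGraph V} (h : G.InClassG) :
    Finite V ∧ Nonempty V := by
  induction h with
  | single G => exact ⟨inferInstance, inferInstance⟩
  | disjointUnion G H _ _ ihG ihH =>
    obtain ⟨_, _⟩ := ihG
    obtain ⟨_, _⟩ := ihH
    exact ⟨inferInstance, inferInstance⟩
  | identify G g H h _ _ ihG ihH =>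
    obtain ⟨_, _⟩ := ihG
    obtain ⟨_, _⟩ := ihH
    exact ⟨inferInstance, inferInstance⟩
  | dominate G _ ih =>
    obtain ⟨_, _⟩ := ih
    exact ⟨inferInstance, inferInstance⟩
  | iso G H e _ ih =>
    obtain ⟨e⟩ := e
    obtain ⟨_, _⟩ := ih
    exact ⟨Finite.of_equiv _ e.toEquiv, e.toEquiv.symm.nonempty⟩

theorem IsTriviallyPerfect.inClassG {V : Type*} {G : SimpleGraph V} (h : G.IsTriviallyPerfect) :
    G.InClassG := by
  induction h with
  | single G => exact .single G
  | disjointUnion G H _ _ ihG ihH => exact .disjointUnion G H ihG ihH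
  | dominate G _ ih => exact .dominate G ih
  | iso G H e _ ih => exact .iso G H e ih

theorem InClassG.exists_isFreeChain (K : Type*) [Field K] {V : Type*} {G : SimpleGraph V}
    (h : G.InClassG) : ∀ [Finite V], ∃ e, IsFreeChain K G ⊤ e := by
  induction h with
  | single G =>
    intro _
    exact exists_isFreeChain_of_forall_not_adj fun v w hvw => hvw.ne (Subsingleton.elim v w)
  | disjointUnion G H hG hH ihG ihH =>
    intro _
    obtain ⟨_, _⟩ := hG.finite_and_nonempty
    obtain ⟨_, _⟩ := hH.finite_and_nonempty
    exact (isGraphUnion_sum G H).exists_isFreeChain_of_disjoint (by simp) ihG ihH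
  | identify G g H h hG hH ihG ihH =>
    intro _
    obtain ⟨_, _⟩ := hG.finite_and_nonempty
    obtain ⟨_, _⟩ := hH.finite_and_nonempty
    exact (isGraphUnion_vertexIdentification G g H h).exists_isFreeChain_of_inter_singleton
      (identEmbedding_eq_inl_iff g h) ihG ihH
  | dominate G hG ih =>
    intro _
    obtain ⟨_, _⟩ := hG.finite_and_nonempty
    obtain ⟨e, he⟩ := ih
    -- Domination acts on witnesses, so the chain is converted to flag-accuracy, which is
    -- `1`-coaccuracy, and back.
    exact exists_isFreeChain_of_isFlagAccurate (isCoaccurate_addDominating he.isFlagAccurate)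
  | iso G H e hG ih =>
    intro _
    obtain ⟨_, _⟩ := hG.finite_and_nonempty
    obtain ⟨e⟩ := e
    exact (isGraphUnion_of_iso e).exists_isFreeChain_of_disjoint (fun _ w => w.elim) ih
      (exists_isFreeChain_of_forall_not_adj fun v => v.elim)

end SimpleGraph

end Union

theorem mainTheorem11 (K : Type v) [Field K] {V : Type u} [Finite V] (G : SimpleGraph V) :
    (G.InClassG → (graphicArrangement K G).IsFlagAccurate) ∧
    (G.IsTriviallyPerfect → (graphicArrangement K G).IsFlagAccurate) ∧
    (∀ k : ℕ, 1 ≤ k → k < Nat.card V →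
      ((graphicArrangement K G).IsCoaccurate k →
        (graphicArrangement K G.addDominating).IsCoaccurate k) ∧
      ((graphicArrangement K G).IsStrictlyCoaccurate k →
        (graphicArrangement K G.addDominating).IsStrictlyCoaccurate k)) ∧
    ((graphicArrangement K G).IsAccurate →
      (graphicArrangement K G.addDominating).IsAccurate) ∧
    ((graphicArrangement K G).IsFlagAccurate →
      (graphicArrangement K G.addDominating).IsFlagAccurate) := by
  have hclass (h : G.InClassG) : (graphicArrangement K G).IsFlagAccurate := by
    obtain ⟨e, he⟩ := h.exists_isFreeChain K
    exact he.isFlagAccurate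
  exact ⟨hclass, fun h => hclass h.inClassG,
    fun k _ _ => ⟨isCoaccurate_addDominating, isStrictlyCoaccurate_addDominating⟩,
    isAccurate_addDominating, isCoaccurate_addDominating⟩
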